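/- A mixed graph $G=(V,D,B)$ consists of a finite node set $V$, a set $D$ of directed edges $v\to w$ and a set $B$ of (unoriented) bidirected edges $v\leftrightarrow w$, both without self-loops; directed cycles are allowed. Let $\Theta$ be the set of pairs $(\Lambda,\Omega)$ of real $V\times V$ matrices such that $\lambda_{vw}=0$ whenever $v\to w\notin D$, $I-\Lambda$ is invertible, $\Omega$ is symmetric positive definite, and $\omega_{vw}=0$ whenever $v\ne w$ and $v\leftrightarrow w\notin B$. Let $\phi_G(\Lambda,\Omega)=(I-\Lambda)^{-T}\Omega(I-\Lambda)^{-1}$ on $\Theta$. A proper algebraic subset of $\Theta$ is a proper subset of $\Theta$ that is defined in $\Theta$ by polynomial equations in the entries of $\Lambda$ and $\Omega$. The graph $G$ is rationally identifiable if there are a proper algebraic subset $A\subset\Theta$ and a rational map $\psi$ such that, for all $(\Lambda,\Omega)\in\Theta\setminus A$, $\psi$ is defined at $\phi_G(\Lambda,\Omega)$ and $\psi(\phi_G(\Lambda,\Omega))=(\Lambda,\Omega)$. It is generically infinite-to-one if there is a proper algebraic subset $A\subset\Theta$ such that the fiber $\{\theta'\in\Theta:\phi_G(\theta')=\phi_G(\theta)\}$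 is infinite for all $\theta\in\Theta\setminus A$. A trek $\pi$ from $v$ to $w$ consists of two directed paths (not necessarily simple, possibly without edges), one ending in $v$ and one ending in $w$, whose starting nodes either coincide or are joined by a bidirected edge; the node sets of the two paths are $\mathrm{Left}(\pi)$ and $\mathrm{Right}(\pi)$, respectively. A half-trek is a trek with $|\mathrm{Left}(\pi)|=1$. A system of treks from $X$ to $Y$ is a set of treks with distinct sources forming the set $X$ and distinct targets forming the set $Y$; it has no sided intersection if any two different treks of it have disjoint left sides and disjoint right sides. Let $\mathrm{pa}(v)=\{w: w\to v\in D\}$, $\mathrm{sib}(v)=\{w: w\leftrightarrow v\in B\}$, and let $\mathrm{htr}(v)$ be the set of nodes in $V\setminus(\{v\}\cup\mathrm{sib}(v))$ that can be reached from $v$ by a half-trek. A set $Y\subseteq V$ satisfies the half-trek criterion with respect to $v$ if (i) $|Y|=|\mathrm{pa}(v)|$, (ii) $Y\cap(\{v\}\cup\mathrm{sib}(v))=\varnothing$, and (iii) there is a system of half-treks with no sided intersection from $Y$ to $\mathrm{pa}(v)$. It satisfies the weak half-trek criterion with respect to $v$ if (i) and (ii) hold and (iii') there is a system of treks with no sided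 intersection from $Y$ to $\mathrm{pa}(v)$ in which, for every $w\in Y\cap\mathrm{htr}(v)$, the trek with source $w$ is a half-trek. Call $G$ HTC-identifiable if there is a family $(Y_v)_{v\in V}$ of subsets of $V$ such that each $Y_v$ satisfies the half-trek criterion with respect to $v$, and a total ordering $\prec$ on $V$ with $w\prec v$ whenever $w\in Y_v\cap\mathrm{htr}(v)$. Call $G$ HTC-infinite-to-one if every family $(Y_v)_{v\in V}$ of subsets of $V$ contains a set $Y_v$ that fails the half-trek criterion with respect to $v$, or contains a pair of sets $Y_v,Y_w$ ($v\ne w$) with $v\in Y_w$ and $w\in Y_v$. Call $G$ weakly HTC-identifiable, respectively weakly HTC-infinite-to-one, if the same conditions hold with the weak half-trek criterion in place of the half-trek criterion. Theorem (Weak HTC). Let $G$ be a mixed graph. If $G$ is weakly HTC-identifiable, then $G$ is rationally identifiable. If $G$ is weakly HTC-infinite-to-one, then $\phi_G$ is generically infinite-to-one. Moreover, $G$ is weakly HTC-identifiable if and only if it is HTC-identifiable, and $G$ is weakly HTC-infinite-to-one if and only if it is HTC-infinite-to-one. -/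

import Mathlib

/-- A mixed graph on the node set `V`: directed edges `D v w` (`v → w`) and bidirected edges
`B v w` (`v ↔ w`), without self-loops; bidirected edges have no orientation. -/
structure MixedGraph (V : Type*) where
  D : V → V → Prop
  B : V → V → Prop
  D_irrefl : ∀ v, ¬ D v v
  B_irrefl : ∀ v, ¬ B v v
  B_symm : ∀ v w, B v w → B w v

/-- A rational map from affine space with coordinates `σ` to affine space with coordinates `τ`:
every coordinate is a quotient of two polynomials. -/
structure RationalMap (σ τ : Type*) where
  num : τ → MvPolynomial σ ℝ
  den : τ → MvPolynomial σ ℝ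
  den_ne_zero : ∀ i, den i ≠ 0

namespace RationalMap

variable {σ τ : Type*}

def IsDefinedAt (ψ : RationalMap σ τ) (x : σ → ℝ) : Prop :=
  ∀ i, MvPolynomial.eval x (ψ.den i) ≠ 0

/-- The value of a rational map (meaningful where the map is defined). -/
noncomputable def eval (ψ : RationalMap σ τ) (x : σ → ℝ) : τ → ℝ :=
  fun i => MvPolynomial.eval x (ψ.num i) / MvPolynomial.eval x (ψ.den i)

end RationalMap

namespace MixedGraph

section Treks

variable {V : Type*} (G : MixedGraph V)

/-- Directed paths (not necessarily simple, possibly without edges). -/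
inductive DiPath : V → V → Type _
  | nil (v : V) : DiPath v v
  | cons {u v w : V} (h : G.D u v) (p : DiPath v w) : DiPath u w

/-- The set of nodes on a directed path. -/
def DiPath.nodes {G : MixedGraph V} : {v w : V} → G.DiPath v w → Set V
  | _, _, .nil v => {v}
  | _, _, .cons (u := u) _ p => insert u p.nodes

/-- A trek from source `v` to target `w`: two directed paths, ending in `v` and in `w`, whose
starting nodes either coincide (the top node) or are joined by a bidirected edge. -/
structure Trek (v w : V) where
  topL : V
  topR : V
  leftPath : G.DiPath topL v
  rightPath : G.DiPath topR w
  link : topL = topR ∨ G.B topL topR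

variable {G} in
/-- `Left(π)`. -/
def Trek.left {v w : V} (π : G.Trek v w) : Set V := π.leftPath.nodes

variable {G} in
/-- `Right(π)`. -/
def Trek.right {v w : V} (π : G.Trek v w) : Set V := π.rightPath.nodes

variable {G} in
/-- A half-trek is a trek with `|Left(π)| = 1`. -/
def Trek.IsHalfTrek {v w : V} (π : G.Trek v w) : Prop := π.left.ncard = 1

/-- A system of treks from `X` to `Y`. As sources are distinct, the treks are indexed by their
sources; as targets are distinct, the source-target assignment is a bijection. -/
structure TrekSystem (X Y : Set V) where
  target : X ≃ Y
  trek : ∀ x : X, G.Trek (x : V) (target x : V)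

variable {G} in
def TrekSystem.NoSidedIntersection {X Y : Set V} (S : G.TrekSystem X Y) : Prop :=
  ∀ i j : X, i ≠ j →
    (S.trek i).left ∩ (S.trek j).left = ∅ ∧ (S.trek i).right ∩ (S.trek j).right = ∅

/-- Parents. -/
def pa (v : V) : Set V := {w | G.D w v}

/-- Siblings. -/
def sib (v : V) : Set V := {w | G.B w v}

/-- Nodes other than `v` and its siblings that can be reached from `v` by a half-trek. -/
def htr (v : V) : Set V :=
  {w | w ∉ ({v} ∪ G.sib v : Set V) ∧ ∃ π : G.Trek v w, π.IsHalfTrek}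

/-- `Y` satisfies the half-trek criterion with respect to `v`. -/
def HalfTrekCriterion (Y : Set V) (v : V) : Prop :=
  Y.ncard = (G.pa v).ncard ∧
  Y ∩ ({v} ∪ G.sib v) = ∅ ∧
  ∃ S : G.TrekSystem Y (G.pa v), S.NoSidedIntersection ∧ ∀ y : Y, (S.trek y).IsHalfTrek

/-- `Y` satisfies the weak half-trek criterion with respect to `v`. -/
def WeakHalfTrekCriterion (Y : Set V) (v : V) : Prop :=
  Y.ncard = (G.pa v).ncard ∧
  Y ∩ ({v} ∪ G.sib v) = ∅ ∧
  ∃ S : G.TrekSystem Y (G.pa v), S.NoSidedIntersection ∧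
    ∀ y : Y, (y : V) ∈ G.htr v → (S.trek y).IsHalfTrek

/-- The graphical condition for identifiability, for a criterion `C` on pairs of a node set and
a node. -/
def IdentifiabilityCondition (C : Set V → V → Prop) : Prop :=
  ∃ Y : V → Set V, (∀ v, C (Y v) v) ∧
    ∃ r : V → V → Prop, IsStrictTotalOrder V r ∧
      ∀ v w, w ∈ Y v ∩ G.htr v → r w v

/-- The graphical condition for nonidentifiability, for a criterion `C` on pairs of a node set
and a node (in a pair `(Y v, Y w)` the nodes `v`, `w` are distinct). -/
def InfiniteToOneCondition (C : Set V → V → Prop) : Prop :=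
  ∀ Y : V → Set V, (∃ v, ¬ C (Y v) v) ∨ ∃ v w, v ≠ w ∧ v ∈ Y w ∧ w ∈ Y v

def HTCIdentifiable : Prop := G.IdentifiabilityCondition G.HalfTrekCriterion

def HTCInfiniteToOne : Prop := InfiniteToOneCondition G.HalfTrekCriterion

def WeakHTCIdentifiable : Prop := G.IdentifiabilityCondition G.WeakHalfTrekCriterion

def WeakHTCInfiniteToOne : Prop := InfiniteToOneCondition G.WeakHalfTrekCriterion

end Treks

section Model

variable {V : Type*} [Fintype V] [DecidableEq V] (G : MixedGraph V)

/-- Matrices with support `D` for which `I - Λ` is invertible. -/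
def regD : Set (Matrix V V ℝ) :=
  {Λ | (∀ v w, ¬ G.D v w → Λ v w = 0) ∧ IsUnit (1 - Λ)}

/-- Positive definite symmetric matrices with support `B`. -/
def PDB : Set (Matrix V V ℝ) :=
  {Ω | Ω.PosDef ∧ ∀ v w, v ≠ w → ¬ G.B v w → Ω v w = 0}

/-- The parameter space. -/
def Theta : Set (Matrix V V ℝ × Matrix V V ℝ) := G.regD ×ˢ G.PDB

/-- The parametrization `(Λ, Ω) ↦ (I - Λ)⁻ᵀ Ω (I - Λ)⁻¹`. -/
noncomputable def phi (θ : Matrix V V ℝ × Matrix V V ℝ) : Matrix V V ℝ :=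
  ((1 - θ.1)⁻¹).transpose * θ.2 * (1 - θ.1)⁻¹

/-- The fiber of the parametrization through `θ`. -/
def fiber (θ : Matrix V V ℝ × Matrix V V ℝ) : Set (Matrix V V ℝ × Matrix V V ℝ) :=
  {θ' | θ' ∈ G.Theta ∧ phi θ' = phi θ}

/-- The entries of a matrix. -/
def entries (M : Matrix V V ℝ) : V × V → ℝ := fun e => M e.1 e.2

/-- The entries of a pair of matrices. -/
def pairEntries (θ : Matrix V V ℝ × Matrix V V ℝ) : (V × V) ⊕ (V × V) → ℝ :=
  Sum.elim (entries θ.1) (entries θ.2)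

/-- Proper algebraic subsets of the parameter space: proper subsets defined in it by polynomial
equations. -/
def IsProperAlgebraicSubset (A : Set (Matrix V V ℝ × Matrix V V ℝ)) : Prop :=
  (∃ P : Set (MvPolynomial ((V × V) ⊕ (V × V)) ℝ),
    A = {θ | θ ∈ G.Theta ∧ ∀ p ∈ P, MvPolynomial.eval (pairEntries θ) p = 0}) ∧
  A ≠ G.Theta

/-- Rational identifiability: outside a proper algebraic subset, a rational map defined there
recovers the parameters from the covariance matrix. -/
def RationallyIdentifiable : Prop :=
  ∃ A, G.IsProperAlgebraicSubset A ∧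
    ∃ ψ : RationalMap (V × V) ((V × V) ⊕ (V × V)),
      ∀ θ ∈ G.Theta \ A,
        ψ.IsDefinedAt (entries (phi θ)) ∧ ψ.eval (entries (phi θ)) = pairEntries θ

/-- All fibers outside a proper algebraic subset are infinite. -/
def GenericallyInfiniteToOne : Prop :=
  ∃ A, G.IsProperAlgebraicSubset A ∧ ∀ θ ∈ G.Theta \ A, (G.fiber θ).Infinite

end Model

end MixedGraph

/-! Comparing the criteria is combinatorial. In a weak system for `v`, a source outside `htr v` is
not half-trek reachable from `v`, so neither is the top of its trek's left side, from which the left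
path leads to the source. Replacing each source by that top yields half-treks and no new nodes of
`htr v` (`WeakHalfTrekCriterion.exists_halfTrekCriterion`). Orderings and the absence of mutual
pairs survive, so only the ordinary criterion needs algebra.

Write Σ for the covariance matrix and P for pa(v). Half-trek systems from Y to P are detected by the
minor of Ω(I - Λ)⁻¹ with rows Y and columns P. The determinant of `linkMatrix` is det(I - Λ) times
this minor, because multiplication by (I - Λ)⁻¹ on the right leaves unit rows outside P. A
permutation in its Leibniz expansion, cut at P, is a family of disjoint directed paths. Conversely,
a linking gives a parameter at which the determinant is nonzero.

Identifiability: column `v` of Λ satisfies (Σ(I - Λ))_wv = 0 for every w not reachable from `v`, and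
((I - Λ)ᵀΣ(I - Λ))_wv = Ω_wv = 0 for w in Y_v ∩ htr(v), whose column is already known. The nonzero
minor makes this linear system injective (`HalfTrekCriterion.mem_rationalFunctions`); induction
along the ordering gives Λ, and then Ω = (I - Λ)ᵀΣ(I - Λ).

Infinite fibers: Σ is constant to first order along Λ' = det(I - Λ)K, Ω' = -(W + Wᵀ), where W = Ω
adj(I - Λ)K. The support condition on Ω' is the linear system `tangentMatrix` in K. If its generic
kernel were trivial, a maximal minor expanded along the blocks of edges with common head would
produce half-trek sets without mutual pairs (`not_HTCInfiniteToOne`). Otherwise a polynomial kernel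
vector defines a vector field whose integral curves stay in fibers (`infinite_fiber`). -/

open Filter Topology
open scoped Matrix

/-! ### Half-treks and equivalence of the weak and ordinary criteria. -/

namespace MixedGraph

section Combinatorics

variable {V : Type*} {G : MixedGraph V}

theorem DiPath.source_mem_nodes {v w : V} (p : G.DiPath v w) : v ∈ p.nodes := by
  cases p <;> simp [DiPath.nodes]

theorem DiPath.target_mem_nodes {v w : V} (p : G.DiPath v w) : w ∈ p.nodes := by
  induction p with
  | nil v => simp [DiPath.nodes]
  | cons h p ih => simp [DiPath.nodes, ih]

/-- Concatenation of directed paths. -/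
def DiPath.append : {u v w : V} → G.DiPath u v → G.DiPath v w → G.DiPath u w
  | _, _, _, .nil _, q => q
  | _, _, _, .cons h p, q => .cons h (p.append q)

theorem Trek.isHalfTrek_iff {v w : V} (π : G.Trek v w) : π.IsHalfTrek ↔ π.left = {v} := by
  constructor
  · intro h
    obtain ⟨a, ha⟩ := Set.ncard_eq_one.mp h
    have : v ∈ π.left := π.leftPath.target_mem_nodes
    rw [ha] at this ⊢
    rw [Set.mem_singleton_iff.mp this]
  · intro h
    simp [Trek.IsHalfTrek, h]

theorem Trek.IsHalfTrek.topL_eq {v w : V} {π : G.Trek v w} (h : π.IsHalfTrek) : π.topL = v := by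
  have h1 : π.topL ∈ π.left := π.leftPath.source_mem_nodes
  rw [π.isHalfTrek_iff.mp h] at h1
  exact h1

/-- The half-trek formed by a source, a link and a directed path. -/
def Trek.ofPath {v t w : V} (h : v = t ∨ G.B v t) (p : G.DiPath t w) : G.Trek v w :=
  ⟨v, t, .nil v, p, h⟩

theorem Trek.isHalfTrek_ofPath {v t w : V} (h : v = t ∨ G.B v t) (p : G.DiPath t w) :
    (Trek.ofPath h p).IsHalfTrek := by
  rw [Trek.isHalfTrek_iff]
  rfl

variable (G) in
/-- Reachability by a half-trek. -/
def Reach (v w : V) : Prop := ∃ t, (v = t ∨ G.B v t) ∧ Nonempty (G.DiPath t w)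

theorem reach_iff {v w : V} : G.Reach v w ↔ ∃ π : G.Trek v w, π.IsHalfTrek := by
  constructor
  · rintro ⟨t, h, ⟨p⟩⟩
    exact ⟨Trek.ofPath h p, Trek.isHalfTrek_ofPath h p⟩
  · rintro ⟨π, h⟩
    refine ⟨π.topR, ?_, ⟨π.rightPath⟩⟩
    have := π.link
    rwa [h.topL_eq] at this

theorem Reach.refl (v : V) : G.Reach v v := ⟨v, Or.inl rfl, ⟨.nil v⟩⟩

theorem Reach.of_mem_sib {v w : V} (h : w ∈ G.sib v) : G.Reach v w :=
  ⟨w, Or.inr (G.B_symm _ _ h), ⟨.nil w⟩⟩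

theorem Reach.trans_path {v u w : V} (h : G.Reach v u) (p : G.DiPath u w) : G.Reach v w := by
  obtain ⟨t, ht, ⟨q⟩⟩ := h
  exact ⟨t, ht, ⟨q.append p⟩⟩

theorem Reach.trans_edge {v u w : V} (h : G.Reach v u) (e : G.D u w) : G.Reach v w :=
  h.trans_path (.cons e (.nil w))

theorem mem_htr_iff {v w : V} : w ∈ G.htr v ↔ w ∉ ({v} ∪ G.sib v : Set V) ∧ G.Reach v w := by
  rw [reach_iff]
  rfl

theorem not_reach_iff {v w : V} : ¬ G.Reach v w ↔ w ∉ G.htr v ∧ w ∉ ({v} ∪ G.sib v : Set V) := by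
  rw [mem_htr_iff]
  constructor
  · intro h
    refine ⟨fun h' => h h'.2, ?_⟩
    rintro (h' | h')
    · rw [Set.mem_singleton_iff.mp h'] at h
      exact h (Reach.refl v)
    · exact h (Reach.of_mem_sib h')
  · rintro ⟨h1, h2⟩ h3
    exact h1 ⟨h2, h3⟩

variable (G) in
/-- Half-treks with right sides that are pairwise disjoint, indexed by their targets, with
distinct sources `src`. -/
def HalfTrekLinking (P : Set V) (src : P → V) : Prop :=
  Function.Injective src ∧ ∃ (top : P → V) (path : ∀ p : P, G.DiPath (top p) p),
    (∀ p, src p = top p ∨ G.B (src p) (top p)) ∧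
    ∀ p q, p ≠ q → Disjoint (path p).nodes (path q).nodes

theorem halfTrekCriterion_iff {Y : Set V} {v : V} :
    G.HalfTrekCriterion Y v ↔ Y ∩ ({v} ∪ G.sib v) = ∅ ∧
      ∃ src : G.pa v → V, Set.range src = Y ∧ G.HalfTrekLinking (G.pa v) src := by
  constructor
  · rintro ⟨-, h2, S, hS, hH⟩
    refine ⟨h2, fun p => S.target.symm p, ?_, ?_, ?_⟩
    · ext y
      constructor
      · rintro ⟨p, rfl⟩
        exact (S.target.symm p).2
      · intro hy
        exact ⟨S.target ⟨y, hy⟩, by simp⟩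
    · exact Subtype.val_injective.comp S.target.symm.injective
    · have key : ∀ p : G.pa v, ∃ (t : V) (q : G.DiPath t p),
          ((S.target.symm p : V) = t ∨ G.B (S.target.symm p) t) ∧
            q.nodes = (S.trek (S.target.symm p)).right := by
        intro p
        obtain ⟨y, rfl⟩ := S.target.surjective p
        rw [Equiv.symm_apply_apply]
        refine ⟨(S.trek y).topR, (S.trek y).rightPath, ?_, rfl⟩
        have := (S.trek y).link
        rwa [(hH y).topL_eq] at this
      choose t q h3 h4 using key
      refine ⟨t, q, h3, fun p p' hp => ?_⟩
      rw [h4, h4, Set.disjoint_iff_inter_eq_empty]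
      exact (hS _ _ (S.target.symm.injective.ne hp)).2
  · rintro ⟨h2, src, rfl, hinj, top, path, hlink, hdis⟩
    refine ⟨?_, h2, ?_⟩
    · rw [← Set.image_univ, Set.ncard_image_of_injective _ hinj, Set.ncard_univ]
      rfl
    · let e := (Equiv.ofInjective src hinj).symm
      have he : ∀ x, src (e x) = x := fun x => Equiv.apply_ofInjective_symm hinj x
      have hl : ∀ x : Set.range src, (x : V) = top (e x) ∨ G.B x (top (e x)) := fun x => by
        have := hlink (e x)
        rwa [he] at this
      refine ⟨⟨e, fun x => Trek.ofPath (hl x) (path (e x))⟩, ?_, ?_⟩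
      · intro i j hij
        constructor
        · change ({(i : V)} : Set V) ∩ {(j : V)} = ∅
          rw [← Set.disjoint_iff_inter_eq_empty, Set.disjoint_singleton]
          exact fun h => hij (Subtype.ext h)
        · rw [← Set.disjoint_iff_inter_eq_empty]
          exact hdis _ _ (e.injective.ne hij)
      · exact fun y => Trek.isHalfTrek_ofPath _ _

theorem HalfTrekCriterion.weak {Y : Set V} {v : V} (h : G.HalfTrekCriterion Y v) :
    G.WeakHalfTrekCriterion Y v := by
  obtain ⟨h1, h2, S, h3, h4⟩ := h
  exact ⟨h1, h2, S, h3, fun y _ => h4 y⟩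

/-- Replacing every source by the top of the left side of its trek turns a set satisfying the
weak criterion into one satisfying the criterion. -/
theorem WeakHalfTrekCriterion.exists_halfTrekCriterion {Y : Set V} {v : V}
    (h : G.WeakHalfTrekCriterion Y v) :
    ∃ Y', G.HalfTrekCriterion Y' v ∧ Y' ∩ G.htr v ⊆ Y ∩ G.htr v := by
  obtain ⟨-, h2, S, hS, hH⟩ := h
  have hY : ∀ y : Y, (y : V) ∉ ({v} ∪ G.sib v : Set V) := fun y hy =>
    Set.notMem_empty _ (h2.subset ⟨y.2, hy⟩)
  -- A half-trek from `v` to the top, continued along the left path, would reach `y`.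
  have htop : ∀ y : Y, (y : V) ∉ G.htr v → ¬ G.Reach v (S.trek y).topL := fun y hy hr =>
    not_reach_iff.mpr ⟨hy, hY y⟩ (hr.trans_path (S.trek y).leftPath)
  have htop' : ∀ y : Y, (y : V) ∈ G.htr v → (S.trek y).topL = y := fun y hy => (hH y hy).topL_eq
  refine ⟨Set.range fun p : G.pa v => (S.trek (S.target.symm p)).topL,
    halfTrekCriterion_iff.mpr ⟨?_, _, rfl, ?_, ?_⟩, ?_⟩
  · rw [← Set.disjoint_iff_inter_eq_empty, Set.disjoint_left]
    rintro _ ⟨p, rfl⟩ hx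
    by_cases hy : (S.target.symm p : V) ∈ G.htr v
    · dsimp only at hx
      rw [htop' _ hy] at hx
      exact hY _ hx
    · exact (not_reach_iff.mp (htop _ hy)).2 hx
  · intro p q hpq
    by_contra hne
    have h3 := (hS _ _ (S.target.symm.injective.ne hne)).1
    refine Set.notMem_empty (S.trek (S.target.symm p)).topL (h3.subset ⟨?_, ?_⟩)
    · exact (S.trek (S.target.symm p)).leftPath.source_mem_nodes
    · dsimp only at hpq
      rw [hpq]
      exact (S.trek (S.target.symm q)).leftPath.source_mem_nodes
  · have key : ∀ p : G.pa v, ∃ (t : V) (q : G.DiPath t p),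
        ((S.trek (S.target.symm p)).topL = t ∨ G.B (S.trek (S.target.symm p)).topL t) ∧
          q.nodes = (S.trek (S.target.symm p)).right := by
      intro p
      obtain ⟨y, rfl⟩ := S.target.surjective p
      rw [Equiv.symm_apply_apply]
      exact ⟨(S.trek y).topR, (S.trek y).rightPath, (S.trek y).link, rfl⟩
    choose t q h3 h4 using key
    refine ⟨t, q, h3, fun p p' hp => ?_⟩
    rw [h4, h4, Set.disjoint_iff_inter_eq_empty]
    exact (hS _ _ (S.target.symm.injective.ne hp)).2
  · rintro _ ⟨⟨p, rfl⟩, hx⟩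
    refine ⟨?_, hx⟩
    by_cases hy : (S.target.symm p : V) ∈ G.htr v
    · dsimp only
      rw [htop' _ hy]
      exact (S.target.symm p).2
    · exact absurd hx (not_reach_iff.mp (htop _ hy)).1

theorem HalfTrekCriterion.reach {Y : Set V} {v w : V} (h : G.HalfTrekCriterion Y v)
    (hw : w ∈ Y) : G.Reach w v := by
  obtain ⟨-, src, rfl, -, top, path, hlink, -⟩ := halfTrekCriterion_iff.mp h
  obtain ⟨p, rfl⟩ := hw
  exact Reach.trans_edge ⟨top p, hlink p, ⟨path p⟩⟩ p.2

/-- Sources of a half-trek system reach the parents, hence the node itself. Mutual membership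
therefore always takes place inside the `htr` sets, which is where replacing sources by tops adds
nothing. -/
theorem HalfTrekCriterion.mem_htr_of_mem {Y Y' : Set V} {v w : V} (h : G.HalfTrekCriterion Y v)
    (h' : G.HalfTrekCriterion Y' w) (hw : w ∈ Y) (hv : v ∈ Y') : v ∈ G.htr w :=
  mem_htr_iff.mpr ⟨fun h1 => Set.notMem_empty v (h'.2.1.subset ⟨hv, h1⟩), h.reach hw⟩

theorem weakHTCIdentifiable_iff : G.WeakHTCIdentifiable ↔ G.HTCIdentifiable := by
  constructor
  · rintro ⟨Y, hY, r, hr, hord⟩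
    choose Y' hY' hsub using fun v => (hY v).exists_halfTrekCriterion
    exact ⟨Y', hY', r, hr, fun v w hw => hord v w (hsub v hw)⟩
  · rintro ⟨Y, hY, h⟩
    exact ⟨Y, fun v => (hY v).weak, h⟩

theorem weakHTCInfiniteToOne_iff : G.WeakHTCInfiniteToOne ↔ G.HTCInfiniteToOne := by
  constructor
  · intro h Y
    exact (h Y).imp (fun ⟨v, hv⟩ => ⟨v, fun h' => hv h'.weak⟩) id
  · intro h Y
    by_contra! hY
    obtain ⟨hY, hpair⟩ := hY
    choose Y' hY' hsub using fun v => (hY v).exists_halfTrekCriterion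
    rcases h Y' with ⟨v, hv⟩ | ⟨v, w, hvw, hv, hw⟩
    · exact hv (hY' v)
    · have h1 := (hsub w ⟨hv, (hY' v).mem_htr_of_mem (hY' w) hw hv⟩).1
      have h2 := (hsub v ⟨hw, (hY' w).mem_htr_of_mem (hY' v) hv hw⟩).1
      exact hpair v w hvw h1 h2

end Combinatorics

end MixedGraph

/-! ### Polynomials on lines and generic parameters. -/

namespace MvPolynomial

/-- The restriction of a polynomial to a line. -/
noncomputable def onLine {σ : Type*} (a b : σ → ℝ) (f : MvPolynomial σ ℝ) : Polynomial ℝ :=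
  aeval (fun i => Polynomial.C (a i) + Polynomial.X * Polynomial.C (b i)) f

theorem eval_onLine {σ : Type*} (a b : σ → ℝ) (f : MvPolynomial σ ℝ) (t : ℝ) :
    (onLine a b f).eval t = eval (fun i => a i + t * b i) f := by
  rw [onLine, ← Polynomial.coe_evalRingHom]
  have : (Polynomial.evalRingHom t).comp (algebraMap ℝ (Polynomial ℝ)) = RingHom.id ℝ := by
    ext; simp
  rw [map_aeval, this]
  have h' : (fun i => Polynomial.evalRingHom t
      (Polynomial.C (a i) + Polynomial.X * Polynomial.C (b i))) = fun i => a i + t * b i := by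
    funext i
    simp only [Polynomial.coe_evalRingHom, Polynomial.eval_add, Polynomial.eval_mul,
      Polynomial.eval_C, Polynomial.eval_X]
  rw [h']
  rfl

end MvPolynomial

namespace Matrix

/-- The quadratic form of `M` is bounded by the sum of the absolute values of its entries times the
squared norm. -/
theorem exists_posDef_one_add_smul {V : Type*} [Fintype V] [DecidableEq V] (M : Matrix V V ℝ)
    (hM : M.IsSymm) : ∃ δ : ℝ, 0 < δ ∧ ∀ t : ℝ, |t| < δ → (1 + t • M).PosDef := by
  set C : ℝ := ∑ i, ∑ j, |M i j| with hC
  have hC0 : 0 ≤ C := by positivity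
  refine ⟨1 / (C + 1), by positivity, fun t ht => PosDef.of_dotProduct_mulVec_pos ?_ ?_⟩
  · ext i j
    simp [one_apply, hM.apply, eq_comm]
  · intro x hx
    have hxx : 0 < x ⬝ᵥ x := by
      have := dotProduct_self_star_pos_iff (v := x) |>.mpr hx
      simpa using this
    have hb : |x ⬝ᵥ M *ᵥ x| ≤ C * (x ⬝ᵥ x) := by
      have hexp : x ⬝ᵥ M *ᵥ x = ∑ i, ∑ j, x i * (M i j * x j) := by
        simp only [dotProduct, mulVec, Finset.mul_sum]
      rw [hexp, hC, Finset.sum_mul]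
      simp only [Finset.sum_mul]
      refine (Finset.abs_sum_le_sum_abs _ _).trans (Finset.sum_le_sum fun i _ => ?_)
      refine (Finset.abs_sum_le_sum_abs _ _).trans ?_
      have hsq : ∀ k, x k * x k ≤ x ⬝ᵥ x := fun k =>
        Finset.single_le_sum (f := fun l => x l * x l) (fun l _ => mul_self_nonneg _)
          (Finset.mem_univ k)
      refine Finset.sum_le_sum fun j _ => ?_
      rw [abs_mul, abs_mul]
      have h1 := hsq i
      have h2 := hsq j
      have h3 : |x i| * |x j| ≤ x ⬝ᵥ x := by
        nlinarith [sq_nonneg (|x i| - |x j|), abs_mul_abs_self (x i), abs_mul_abs_self (x j)]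
      calc |x i| * (|M i j| * |x j|) = |M i j| * (|x i| * |x j|) := by ring
        _ ≤ _ := mul_le_mul_of_nonneg_left h3 (abs_nonneg _)
    have ht' : |t| * C < 1 := by
      rw [lt_div_iff₀ (by positivity)] at ht
      nlinarith [abs_nonneg t]
    have h4 : |t * (x ⬝ᵥ M *ᵥ x)| ≤ (|t| * C) * (x ⬝ᵥ x) := by
      rw [abs_mul, mul_assoc]
      exact mul_le_mul_of_nonneg_left hb (abs_nonneg _)
    have h5 := neg_abs_le (t * (x ⬝ᵥ M *ᵥ x))
    have : star x ⬝ᵥ (1 + t • M) *ᵥ x = x ⬝ᵥ x + t * (x ⬝ᵥ M *ᵥ x) := by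
      simp [add_mulVec, smul_mulVec, dotProduct_add]
    rw [this]
    nlinarith

end Matrix

namespace MixedGraph

section Generic

variable {V : Type*} [Fintype V] [DecidableEq V] (G : MixedGraph V)

/-- The linear space spanned by the parameter space. -/
def support : Submodule ℝ (Matrix V V ℝ × Matrix V V ℝ) where
  carrier := {θ | (∀ v w, ¬ G.D v w → θ.1 v w = 0) ∧ θ.2.IsSymm ∧
    ∀ v w, v ≠ w → ¬ G.B v w → θ.2 v w = 0}
  add_mem' := by
    rintro a b ⟨h1, h2, h3⟩ ⟨h4, h5, h6⟩
    exact ⟨fun v w h => by simp [h1 v w h, h4 v w h], h2.add h5,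
      fun v w h h' => by simp [h3 v w h h', h6 v w h h']⟩
  zero_mem' := by simp [Matrix.IsSymm]
  smul_mem' := by
    rintro c a ⟨h1, h2, h3⟩
    exact ⟨fun v w h => by simp [h1 v w h], h2.smul c, fun v w h h' => by simp [h3 v w h h']⟩

variable {G}

theorem Theta_subset_support {θ : Matrix V V ℝ × Matrix V V ℝ} (h : θ ∈ G.Theta) :
    θ ∈ G.support :=
  ⟨h.1.1, by simpa [Matrix.IsHermitian, Matrix.IsSymm] using h.2.1.1, h.2.2⟩

/-- The polynomial `det (I - Λ)`. -/
noncomputable def detPoly (V : Type*) [Fintype V] [DecidableEq V] :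
    MvPolynomial ((V × V) ⊕ (V × V)) ℝ :=
  (1 - Matrix.of fun v w => MvPolynomial.X (Sum.inl (v, w)) :
    Matrix V V (MvPolynomial ((V × V) ⊕ (V × V)) ℝ)).det

theorem eval_det {ι σ : Type*} [Fintype ι] [DecidableEq ι] (x : σ → ℝ)
    (M : Matrix ι ι (MvPolynomial σ ℝ)) :
    MvPolynomial.eval x M.det = (M.map (MvPolynomial.eval x)).det := by
  rw [RingHom.map_det]
  rfl

theorem eval_detPoly (θ : Matrix V V ℝ × Matrix V V ℝ) :
    MvPolynomial.eval (pairEntries θ) (detPoly V) = (1 - θ.1).det := by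
  rw [detPoly, eval_det]
  congr 1
  ext i j
  simp [Matrix.one_apply, pairEntries, entries, apply_ite]

omit [Fintype V] [DecidableEq V] in
theorem pairEntries_line (θ η : Matrix V V ℝ × Matrix V V ℝ) (t : ℝ) :
    (fun i => pairEntries θ i + t * pairEntries η i) = pairEntries (θ + t • η) := by
  funext i
  rcases i with i | i <;> simp [pairEntries, entries]

/-- A polynomial that does not vanish on the linear space spanned by the parameter space does not
vanish on the parameter space. -/
theorem exists_mem_Theta_eval_ne_zero {f : MvPolynomial ((V × V) ⊕ (V × V)) ℝ}
    {η : Matrix V V ℝ × Matrix V V ℝ} (hη : η ∈ G.support)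
    (hf : MvPolynomial.eval (pairEntries η) f ≠ 0) :
    ∃ θ ∈ G.Theta, MvPolynomial.eval (pairEntries θ) f ≠ 0 := by
  -- Parameters on the line from this base point to `η` have positive definite second component near
  -- the base point. There, all but finitely many also avoid the zeros of `f` and of det(I - Λ).
  let θ₁ : Matrix V V ℝ × Matrix V V ℝ := (0, 1)
  have hθ₁ : θ₁ ∈ G.support :=
    ⟨fun _ _ _ => rfl, Matrix.isSymm_one, fun v w h _ => by simp [θ₁, h]⟩
  have hδ' : η - θ₁ ∈ G.support := G.support.sub_mem hη hθ₁
  let q₁ := MvPolynomial.onLine (pairEntries θ₁) (pairEntries (η - θ₁)) f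
  let q₂ := MvPolynomial.onLine (pairEntries θ₁) (pairEntries (η - θ₁)) (detPoly V)
  have h₁ : ∀ t, q₁.eval t = MvPolynomial.eval (pairEntries (θ₁ + t • (η - θ₁))) f := fun t => by
    rw [MvPolynomial.eval_onLine, pairEntries_line]
  have h₂ : ∀ t, q₂.eval t = (1 - (θ₁ + t • (η - θ₁)).1).det := fun t => by
    rw [MvPolynomial.eval_onLine, pairEntries_line, eval_detPoly]
  have hq₁ : q₁ ≠ 0 := fun h => hf <| by
    have := h₁ 1
    rw [h] at this
    simpa using this.symm
  have hq₂ : q₂ ≠ 0 := fun h => by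
    have := h₂ 0
    rw [h] at this
    simp [θ₁] at this
  obtain ⟨δ, hδ, hpos⟩ := Matrix.exists_posDef_one_add_smul _ hδ'.2.1
  have hfin : (q₁ * q₂).rootSet ℝ |>.Finite := Polynomial.rootSet_finite _ _
  have hinf : (Set.Ioo (-δ) δ).Infinite := Set.Ioo_infinite (by linarith)
  obtain ⟨t, ht, hroot⟩ := hinf.exists_notMem_finite hfin
  rw [Polynomial.mem_rootSet_of_ne (mul_ne_zero hq₁ hq₂), map_mul, Polynomial.coe_aeval_eq_eval,
    mul_eq_zero, not_or, h₁, h₂] at hroot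
  have hsupp : θ₁ + t • (η - θ₁) ∈ G.support :=
    G.support.add_mem hθ₁ (G.support.smul_mem _ hδ')
  exact ⟨θ₁ + t • (η - θ₁), ⟨⟨hsupp.1, (Matrix.isUnit_iff_isUnit_det _).mpr
    (isUnit_iff_ne_zero.mpr hroot.2)⟩, hpos t (abs_lt.mpr ht), hsupp.2.2⟩, hroot.1⟩

variable (G) in
/-- The filter of sets that contain the complement of a proper algebraic subset of the parameter
space. -/
def generic : Filter (Matrix V V ℝ × Matrix V V ℝ) where
  sets := {s | ∃ f : MvPolynomial ((V × V) ⊕ (V × V)) ℝ,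
    (∃ θ ∈ G.Theta, MvPolynomial.eval (pairEntries θ) f ≠ 0) ∧
    ∀ θ ∈ G.Theta, MvPolynomial.eval (pairEntries θ) f ≠ 0 → θ ∈ s}
  univ_sets := ⟨1, by
    obtain ⟨θ, h, -⟩ := exists_mem_Theta_eval_ne_zero (G := G) (f := 1) (G.support.zero_mem)
      (by simp)
    exact ⟨θ, h, by simp⟩, fun _ _ _ => trivial⟩
  sets_of_superset := by
    rintro s t ⟨f, h1, h2⟩ hst
    exact ⟨f, h1, fun θ h h' => hst (h2 θ h h')⟩
  inter_sets := by
    rintro s t ⟨f, ⟨θ, hθ, hf⟩, h2⟩ ⟨g, ⟨η, hη, hg⟩, h4⟩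
    refine ⟨f * g, ?_, fun θ h h' => ?_⟩
    · have hsub : η - θ ∈ G.support :=
        G.support.sub_mem (Theta_subset_support hη) (Theta_subset_support hθ)
      let q₁ := MvPolynomial.onLine (pairEntries θ) (pairEntries (η - θ)) f
      let q₂ := MvPolynomial.onLine (pairEntries θ) (pairEntries (η - θ)) g
      have h₁ : ∀ t, q₁.eval t = MvPolynomial.eval (pairEntries (θ + t • (η - θ))) f :=
        fun t => by rw [MvPolynomial.eval_onLine, pairEntries_line]
      have h₂ : ∀ t, q₂.eval t = MvPolynomial.eval (pairEntries (θ + t • (η - θ))) g :=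
        fun t => by rw [MvPolynomial.eval_onLine, pairEntries_line]
      have hq₁ : q₁ ≠ 0 := fun h => hf <| by
        have := h₁ 0
        rw [h] at this
        simpa using this.symm
      have hq₂ : q₂ ≠ 0 := fun h => hg <| by
        have := h₂ 1
        rw [h] at this
        simpa using this.symm
      obtain ⟨r, hr⟩ := Polynomial.exists_eval_ne_zero_of_natDegree_lt_card _
        (mul_ne_zero hq₁ hq₂) (Cardinal.natCast_lt_aleph0.trans_le (Cardinal.aleph0_le_mk ℝ))
      -- The chosen point of the line may leave the parameter space, but it stays in its linear
      -- span, which suffices.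
      refine exists_mem_Theta_eval_ne_zero (η := θ + r • (η - θ))
        (G.support.add_mem (Theta_subset_support hθ) (G.support.smul_mem _ hsub)) ?_
      rwa [Polynomial.eval_mul, h₁, h₂, ← map_mul] at hr
    · rw [map_mul, mul_ne_zero_iff] at h'
      exact ⟨h2 θ h h'.1, h4 θ h h'.2⟩

instance : (generic G).NeBot := by
  refine ⟨fun h => ?_⟩
  obtain ⟨f, ⟨θ, h1, h2⟩, h3⟩ := h ▸ Filter.mem_bot (s := (∅ : Set (Matrix V V ℝ × Matrix V V ℝ)))
  exact h3 θ h1 h2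

theorem eventually_generic_of_eval {p : Matrix V V ℝ × Matrix V V ℝ → Prop}
    {f : MvPolynomial ((V × V) ⊕ (V × V)) ℝ} {η : Matrix V V ℝ × Matrix V V ℝ}
    (hη : η ∈ G.support) (hf : MvPolynomial.eval (pairEntries η) f ≠ 0)
    (h : ∀ θ ∈ G.Theta, MvPolynomial.eval (pairEntries θ) f ≠ 0 → p θ) :
    ∀ᶠ θ in G.generic, p θ :=
  ⟨f, exists_mem_Theta_eval_ne_zero hη hf, h⟩

theorem eventually_mem_Theta : ∀ᶠ θ in G.generic, θ ∈ G.Theta :=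
  eventually_generic_of_eval (f := 1) G.support.zero_mem (by simp) fun _ h _ => h

theorem exists_isProperAlgebraicSubset {p : Matrix V V ℝ × Matrix V V ℝ → Prop}
    (h : ∀ᶠ θ in G.generic, p θ) :
    ∃ A, G.IsProperAlgebraicSubset A ∧ ∀ θ ∈ G.Theta \ A, p θ := by
  obtain ⟨f, ⟨θ, hθ, hf⟩, hp⟩ := h
  refine ⟨{θ | θ ∈ G.Theta ∧ ∀ q ∈ ({f} : Set _), MvPolynomial.eval (pairEntries θ) q = 0},
    ⟨⟨_, rfl⟩, fun hA => ?_⟩, fun η hη => hp η hη.1 fun h0 => hη.2 ⟨hη.1, ?_⟩⟩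
  · exact hf ((hA.symm.subset hθ).2 f rfl)
  · rintro q rfl
    exact h0

end Generic

end MixedGraph

/-! ### Half-trek linkings give nonsingular matrices. -/

namespace Matrix

/-- A pattern containing a perfect matching between `f` and `g` has a symmetric matrix with
nonsingular submatrix at the rows `f` and columns `g`. -/
theorem exists_isSymm_det_submatrix_ne_zero {V : Type*} [DecidableEq V] (E : V → V → Prop)
    (hrefl : ∀ v, E v v) (hsymm : ∀ v w, E v w → E w v) :
    ∀ (n : ℕ) (f g : Fin n → V), Function.Injective f → Function.Injective g →
      (∀ i, E (f i) (g i)) → ∃ M : Matrix V V ℝ, M.IsSymm ∧ (∀ v w, ¬ E v w → M v w = 0) ∧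
        (M.submatrix f g).det ≠ 0 := by
  intro n
  induction n with
  | zero => exact fun f g _ _ _ => ⟨0, isSymm_zero, fun _ _ _ => rfl, by simp⟩
  | succ n ih =>
    intro f g hf hg hE
    by_cases h : ∃ i, f i ∉ Set.range g
    · obtain ⟨i, hi⟩ := h
      obtain ⟨M, hM, hME, hdet⟩ := ih (f ∘ i.succAbove) (g ∘ i.succAbove)
        (hf.comp Fin.succAbove_right_injective) (hg.comp Fin.succAbove_right_injective)
        fun j => hE _
      -- The mirrored entry sits in column `f i`, which is not a column of the submatrix. Adding `s
      -- • N` thus changes only the entry `(i, i)`, and the determinant is affine in `s` with slope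
      -- plus or minus the smaller minor.
      let N : Matrix V V ℝ := of fun v w =>
        if (v = f i ∧ w = g i) ∨ (v = g i ∧ w = f i) then 1 else 0
      have hN : N.IsSymm := by
        ext v w
        simp only [transpose_apply, N, of_apply]
        congr 1
        rw [eq_iff_iff]
        tauto
      have hNE : ∀ v w, ¬ E v w → N v w = 0 := by
        intro v w hvw
        simp only [N, of_apply]
        rw [if_neg]
        rintro (⟨rfl, rfl⟩ | ⟨rfl, rfl⟩)
        · exact hvw (hE i)
        · exact hvw (hsymm _ _ (hE i))
      have hsub : ∀ s : ℝ, ((M + s • N).submatrix f g).det = (M.submatrix f g).det +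
          s * ((-1) ^ (i + i : ℕ) *
            (M.submatrix (f ∘ i.succAbove) (g ∘ i.succAbove)).det) := by
        intro s
        have h1 : (M + s • N).submatrix f g = (M.submatrix f g).updateRow i
            ((M.submatrix f g) i + s • Pi.single i 1) := by
          ext k j
          have h2 : ¬ (f k = g i ∧ g j = f i) := fun h => hi ⟨j, h.2⟩
          by_cases hk : k = i
          · subst hk
            by_cases hj : j = k
            · subst hj
              simp [N]
            · simp [N, hg.eq_iff, hj, h2]
          · simp [N, hf.eq_iff, hk, h2, updateRow_ne]
        rw [h1, det_updateRow_add, updateRow_eq_self, det_updateRow_smul, ← adjugate_apply,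
          adjugate_fin_succ_eq_det_submatrix]
        rfl
      have hne : ((-1 : ℝ)) ^ (i + i : ℕ) *
          (M.submatrix (f ∘ i.succAbove) (g ∘ i.succAbove)).det ≠ 0 :=
        mul_ne_zero (pow_ne_zero _ (by norm_num)) hdet
      have hex : ∃ s : ℝ, ((M + s • N).submatrix f g).det ≠ 0 := by
        by_cases h0 : (M.submatrix f g).det = 0
        · exact ⟨1, by rw [hsub, h0, zero_add, one_mul]; exact hne⟩
        · exact ⟨0, by rw [hsub, zero_mul, add_zero]; exact h0⟩
      obtain ⟨s, hs⟩ := hex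
      exact ⟨M + s • N, hM.add (hN.smul s), fun v w hvw => by simp [hME v w hvw, hNE v w hvw], hs⟩
    · push Not at h
      -- Now `f` and `g` have the same range, so the identity matrix restricts to a permutation
      -- matrix.
      choose σ hσ using h
      have hσinj : Function.Injective σ := fun a b hab => hf (by rw [← hσ a, ← hσ b, hab])
      let e : Equiv.Perm (Fin (n + 1)) :=
        Equiv.ofBijective σ (Finite.injective_iff_bijective.mp hσinj)
      refine ⟨1, isSymm_one, fun v w hvw => ?_, ?_⟩
      · rw [one_apply_ne]
        rintro rfl
        exact hvw (hrefl _)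
      · have h1 : (1 : Matrix V V ℝ).submatrix f g =
            (1 : Matrix (Fin (n + 1)) (Fin (n + 1)) ℝ).submatrix e id := by
          ext a b
          simp only [submatrix_apply, one_apply, ← hσ a, hg.eq_iff, id, e,
            Equiv.ofBijective_apply]
        rw [h1, det_permute, det_one, mul_one]
        simp

theorem exists_isSymm_mulVec_injOn {V P : Type*} [Fintype V] [DecidableEq V] [Finite P]
    (E : V → V → Prop) (hrefl : ∀ v, E v v) (hsymm : ∀ v w, E v w → E w v) (f g : P → V)
    (hf : Function.Injective f) (hg : Function.Injective g) (hE : ∀ i, E (f i) (g i)) :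
    ∃ M : Matrix V V ℝ, M.IsSymm ∧ (∀ v w, ¬ E v w → M v w = 0) ∧
      ∀ x : V → ℝ, (∀ w ∉ Set.range g, x w = 0) → (∀ p, (M *ᵥ x) (f p) = 0) → x = 0 := by
  obtain ⟨n, ⟨e⟩⟩ := Finite.exists_equiv_fin P
  obtain ⟨M, h1, h2, h3⟩ := exists_isSymm_det_submatrix_ne_zero E hrefl hsymm n
    (f ∘ e.symm) (g ∘ e.symm) (hf.comp e.symm.injective) (hg.comp e.symm.injective)
    fun i => hE _
  refine ⟨M, h1, h2, fun x hx hM => ?_⟩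
  have hg' := hg.comp e.symm.injective
  have h4 : (M.submatrix (f ∘ e.symm) (g ∘ e.symm)) *ᵥ (x ∘ g ∘ e.symm) = 0 := by
    funext i
    have h5 := hM (e.symm i)
    simp only [mulVec, dotProduct, submatrix_apply, Function.comp_apply, Pi.zero_apply] at h5 ⊢
    rw [← h5]
    exact Fintype.sum_of_injective (g ∘ e.symm) hg' _ _ (fun w hw => by
      rw [hx w (by rwa [Set.range_comp, e.symm.surjective.range_eq, Set.image_univ] at hw),
        mul_zero]) fun j => rfl
  have h5 : x ∘ g ∘ e.symm = 0 := by
    by_contra hne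
    exact h3 (exists_mulVec_eq_zero_iff.mp ⟨_, hne, h4⟩)
  funext w
  by_cases hw : w ∈ Set.range g
  · obtain ⟨p, rfl⟩ := hw
    simpa using congrFun h5 (e p)
  · exact hx w hw

end Matrix

namespace MixedGraph

section Linking

variable {V : Type*} {G : MixedGraph V}

/-- A directed path contains a simple path, which is recorded by a cyclic permutation. -/
theorem DiPath.exists_perm [DecidableEq V] {a b : V} (p : G.DiPath a b) :
    ∀ u ∈ p.nodes, ∃ ρ : Equiv.Perm V, ρ b = u ∧ (∀ w ∉ p.nodes, ρ w = w) ∧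
      ∀ w ≠ b, ρ w = w ∨ G.D w (ρ w) := by
  induction p with
  | nil v =>
    rintro u rfl
    exact ⟨1, rfl, fun _ _ => rfl, fun _ _ => Or.inl rfl⟩
  | @cons a v b h p ih =>
    intro u hu
    by_cases hu' : u ∈ p.nodes
    · obtain ⟨ρ, h1, h2, h3⟩ := ih u hu'
      exact ⟨ρ, h1, fun w hw => h2 w fun hw' => hw (Or.inr hw'), h3⟩
    · obtain rfl : u = a := hu.resolve_right hu'
      obtain ⟨ρ, h1, h2, h3⟩ := ih v p.source_mem_nodes
      -- As `ρ` fixes `u` and sends `b` to `v`, the swap inserts `u` into the cycle: `b` goes to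
      -- `u`, and `u` goes to `v` along the new edge.
      refine ⟨Equiv.swap v u * ρ, by simp [h1], fun w hw => ?_, fun w hw => ?_⟩
      · have hw1 : w ≠ u := fun h => hw (Or.inl h)
        have hw2 : w ∉ p.nodes := fun h => hw (Or.inr h)
        have hw3 : w ≠ v := fun h => hw2 (h ▸ p.source_mem_nodes)
        rw [Equiv.Perm.mul_apply, h2 w hw2, Equiv.swap_apply_of_ne_of_ne hw3 hw1]
      · rw [Equiv.Perm.mul_apply]
        have hv : ρ w ≠ v := fun h => hw (ρ.injective (h.trans h1.symm))
        by_cases hwu : ρ w = u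
        · obtain rfl : w = u := ρ.injective (hwu.trans (h2 u hu').symm)
          rw [hwu, Equiv.swap_apply_right]
          exact Or.inr h
        · rw [Equiv.swap_apply_of_ne_of_ne hv hwu]
          exact h3 w hw

/-- The cycles of the separate paths have disjoint supports, so they glue to one permutation. Each
cycle follows its path and closes up from the target back to the top. -/
theorem exists_perm_of_disjoint_paths [Finite V] {P : Set V} {top : P → V}
    (path : ∀ p : P, G.DiPath (top p) p)
    (hdis : ∀ p q, p ≠ q → Disjoint (path p).nodes (path q).nodes) :
    ∃ ρ : Equiv.Perm V, (∀ p : P, ρ p = top p) ∧ ∀ w ∉ P, ρ w = w ∨ G.D w (ρ w) := by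
  classical
  choose ρ h1 h2 h3 using fun p : P => (path p).exists_perm (top p) (path p).source_mem_nodes
  have hmaps : ∀ p w, w ∈ (path p).nodes → ρ p w ∈ (path p).nodes := by
    intro p w hw
    by_contra h
    rw [(ρ p).injective (h2 p _ h)] at h
    exact h hw
  have huniq : ∀ p q w, w ∈ (path p).nodes → w ∈ (path q).nodes → p = q := by
    intro p q w hp hq
    by_contra h
    exact Set.disjoint_left.mp (hdis p q h) hp hq
  let F : V → V := fun w => if h : ∃ p, w ∈ (path p).nodes then ρ h.choose w else w
  have hF1 : ∀ p w, w ∈ (path p).nodes → F w = ρ p w := by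
    intro p w hw
    have h : ∃ p, w ∈ (path p).nodes := ⟨p, hw⟩
    simp only [F, dif_pos h]
    rw [huniq _ _ w h.choose_spec hw]
  have hF2 : ∀ w, (∀ p, w ∉ (path p).nodes) → F w = w := by
    intro w hw
    simp only [F]
    rw [dif_neg]
    rintro ⟨p, hp⟩
    exact hw p hp
  have hinj : Function.Injective F := by
    intro a b hab
    by_cases ha : ∃ p, a ∈ (path p).nodes
    · obtain ⟨p, hp⟩ := ha
      by_cases hb : ∃ q, b ∈ (path q).nodes
      · obtain ⟨q, hq⟩ := hb
        rw [hF1 p a hp, hF1 q b hq] at hab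
        obtain rfl := huniq p q _ (hmaps p a hp) (hab ▸ hmaps q b hq)
        exact (ρ p).injective hab
      · push Not at hb
        rw [hF1 p a hp, hF2 b hb] at hab
        exact absurd (hab ▸ hmaps p a hp) (hb p)
    · push Not at ha
      by_cases hb : ∃ q, b ∈ (path q).nodes
      · obtain ⟨q, hq⟩ := hb
        rw [hF2 a ha, hF1 q b hq] at hab
        exact absurd (hab ▸ hmaps q b hq) (ha q)
      · push Not at hb
        rwa [hF2 a ha, hF2 b hb] at hab
  refine ⟨Equiv.ofBijective F (Finite.injective_iff_bijective.mp hinj), fun p => ?_,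
    fun w hw => ?_⟩
  · rw [Equiv.ofBijective_apply, hF1 p p (path p).target_mem_nodes, h1]
  · rw [Equiv.ofBijective_apply]
    by_cases h : ∃ p, w ∈ (path p).nodes
    · obtain ⟨p, hp⟩ := h
      rw [hF1 p w hp]
      exact h3 p w fun h => hw (h ▸ p.2)
    · push Not at h
      exact Or.inl (hF2 w h)

open Classical in
/-- The matrix with the rows `src p` of `Ω` in the positions `p ∈ P` and the rows of `I - Λ` in
the other positions. -/
noncomputable def linkMatrix {R : Type*} [CommRing R] {P : Set V} (src : P → V)
    (Λ Ω : Matrix V V R) : Matrix V V R :=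
  Matrix.of fun w u => if h : w ∈ P then Ω (src ⟨w, h⟩) u else (1 - Λ) w u

theorem linkMatrix_of_mem {R : Type*} [CommRing R] {P : Set V} (src : P → V)
    (Λ Ω : Matrix V V R) (p : P) : linkMatrix src Λ Ω p = Ω (src p) := by
  funext u
  simp [linkMatrix]

theorem linkMatrix_of_notMem {R : Type*} [CommRing R] [DecidableEq V] {P : Set V} (src : P → V)
    (Λ Ω : Matrix V V R) {w : V} (hw : w ∉ P) : linkMatrix src Λ Ω w = (1 - Λ) w := by
  funext u
  simp [linkMatrix, hw, Matrix.one_apply]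

/-- Ideally each row outside `P` would be the unit vector at `ρ w`, leaving only a block of `Ω` to
be made nonsingular. Rows of I - Λ have diagonal entry 1, so this ideal matrix is reached only as a
limit, after rescaling rows. -/
theorem exists_mem_support_det_linkMatrix_ne_zero [Fintype V] [DecidableEq V] {P : Set V}
    {src : P → V} (h : G.HalfTrekLinking P src) :
    ∃ θ ∈ G.support, (linkMatrix src θ.1 θ.2).det ≠ 0 := by
  classical
  obtain ⟨hsrc, top, path, hlink, hdis⟩ := h
  have htop : Function.Injective top := by
    intro p q hpq
    by_contra hne
    have h1 : top q ∈ (path p).nodes :=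
      Set.mem_of_eq_of_mem hpq.symm (path p).source_mem_nodes
    exact Set.disjoint_left.mp (hdis p q hne) h1 (path q).source_mem_nodes
  obtain ⟨ρ, hρP, hρ⟩ := exists_perm_of_disjoint_paths path hdis
  obtain ⟨Ω, hsym, hsupp, hΩ⟩ := Matrix.exists_isSymm_mulVec_injOn
    (fun v w => v = w ∨ G.B v w) (fun v => Or.inl rfl)
    (fun v w h => h.imp Eq.symm (G.B_symm _ _)) src top hsrc htop hlink
  let d : V → ℝ := fun w => if ρ w = w then 1 else 0
  let m : V → V → ℝ := fun w u => if ρ w ≠ w ∧ u = ρ w then 1 else 0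
  -- At `ε = 0` the rows outside `P` are the unit vectors at `ρ w`. For `ε > 0` their diagonal
  -- entries are positive, so dividing by these gives rows of I - Λ.
  let T : ℝ → Matrix V V ℝ := fun ε => Matrix.of fun w u =>
    if h : w ∈ P then Ω (src ⟨w, h⟩) u else (d w + ε) * (1 : Matrix V V ℝ) w u + m w u
  have hT0 : (T 0).det ≠ 0 := by
    intro hdet
    obtain ⟨x, hx, hTx⟩ := Matrix.exists_mulVec_eq_zero_iff.mpr hdet
    refine hx (hΩ x (fun w hw => ?_) fun p => ?_)
    · obtain ⟨u, rfl⟩ := ρ.surjective w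
      have hu : u ∉ P := fun hu => hw ⟨⟨u, hu⟩, (hρP ⟨u, hu⟩).symm⟩
      have h1 := congrFun hTx u
      have h2 : T 0 u = Pi.single (ρ u) 1 := by
        funext k
        simp only [T, Matrix.of_apply, dif_neg hu, d, m, add_zero, Matrix.one_apply,
          Pi.single_apply]
        by_cases h3 : ρ u = u
        · simp [h3, eq_comm]
        · simp [h3]
      rw [Matrix.mulVec, h2] at h1
      simpa using h1
    · have h1 := congrFun hTx p
      have h2 : T 0 p = Ω (src p) := by
        funext k
        simp [T]
      rw [Matrix.mulVec, h2] at h1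
      exact h1
  have hcont : Continuous fun ε => (T ε).det := by
    refine Continuous.matrix_det (continuous_pi fun w => continuous_pi fun u => ?_)
    simp only [T, Matrix.of_apply]
    split_ifs <;> fun_prop
  obtain ⟨ε, hε, hpos⟩ := (((hcont.tendsto 0).eventually_ne hT0).filter_mono
    (nhdsWithin_le_nhds (s := Set.Ioi 0)) |>.and self_mem_nhdsWithin).exists
  have hpos : 0 < ε := hpos
  have hd : ∀ w, 0 < d w + ε := fun w => by
    simp only [d]
    split_ifs <;> linarith
  let Λ : Matrix V V ℝ := Matrix.of fun w u => if w ∈ P then 0 else - m w u / (d w + ε)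
  refine ⟨(Λ, Ω), ⟨fun w u hwu => ?_, hsym, fun v w hvw hB => hsupp v w (by tauto)⟩, ?_⟩
  · simp only [Λ, Matrix.of_apply]
    split_ifs with hw
    · rfl
    · have : m w u = 0 := by
        simp only [m]
        rw [if_neg]
        rintro ⟨h1, rfl⟩
        exact hwu ((hρ w hw).resolve_left h1)
      simp [this]
  · let c : V → ℝ := fun w => if w ∈ P then 1 else d w + ε
    have hfac : T ε = Matrix.diagonal c * linkMatrix src Λ Ω := by
      ext w u
      rw [Matrix.diagonal_mul]
      by_cases hw : w ∈ P
      · rw [linkMatrix_of_mem src Λ Ω ⟨w, hw⟩]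
        simp [T, c, hw]
      · rw [linkMatrix_of_notMem src Λ Ω hw]
        have := (hd w).ne'
        simp only [T, c, Λ, hw, Matrix.of_apply, Matrix.sub_apply, if_false, dif_neg,
          not_false_eq_true]
        field_simp
        ring
    intro h0
    rw [hfac, Matrix.det_mul, h0, mul_zero] at hε
    exact hε rfl

end Linking

end MixedGraph

/-! ### Rational identifiability. -/

namespace MixedGraph

section Rational

variable {V : Type*} [Fintype V] [DecidableEq V] {G : MixedGraph V}

omit [Fintype V] in
theorem map_linkMatrix {R S : Type*} [CommRing R] [CommRing S] (φ : R →+* S) {P : Set V}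
    (src : P → V) (Λ Ω : Matrix V V R) :
    (linkMatrix src Λ Ω).map φ = linkMatrix src (Λ.map φ) (Ω.map φ) := by
  ext w u
  by_cases h : w ∈ P
  · simp [linkMatrix, h]
  · have h1 : ((1 - Λ).map φ : Matrix V V S) = 1 - Λ.map φ := by
      rw [Matrix.map_sub _ (map_sub φ), Matrix.map_one _ (map_zero φ) (map_one φ)]
    rw [linkMatrix_of_notMem _ _ _ h, ← h1, Matrix.map_apply, linkMatrix_of_notMem _ _ _ h,
      Matrix.map_apply]

theorem HalfTrekLinking.eventually_det_ne_zero {P : Set V} {src : P → V}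
    (h : G.HalfTrekLinking P src) :
    ∀ᶠ θ in G.generic, (linkMatrix src θ.1 θ.2).det ≠ 0 := by
  obtain ⟨η, hη, hdet⟩ := exists_mem_support_det_linkMatrix_ne_zero h
  have key : ∀ θ : Matrix V V ℝ × Matrix V V ℝ, MvPolynomial.eval (pairEntries θ)
      (linkMatrix src (Matrix.of fun v w => MvPolynomial.X (Sum.inl (v, w)))
        (Matrix.of fun v w => MvPolynomial.X (Sum.inr (v, w)))).det =
      (linkMatrix src θ.1 θ.2).det := by
    intro θ
    rw [eval_det, map_linkMatrix]
    congr 2 <;>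
    · ext v w
      simp [pairEntries, entries]
  refine eventually_generic_of_eval hη (by rwa [key]) fun θ _ hθ => ?_
  rwa [key] at hθ

variable (G) in
/-- The ring of functions of the parameters that are, generically, rational functions of the
covariance matrix. -/
def rationalFunctions : Subring (Matrix V V ℝ × Matrix V V ℝ → ℝ) where
  carrier := {g | ∃ n d : MvPolynomial (V × V) ℝ, ∀ᶠ θ in G.generic,
    MvPolynomial.eval (entries (phi θ)) d ≠ 0 ∧
    g θ = MvPolynomial.eval (entries (phi θ)) n / MvPolynomial.eval (entries (phi θ)) d}
  mul_mem' := by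
    rintro f g ⟨n, d, h⟩ ⟨n', d', h'⟩
    refine ⟨n * n', d * d', ?_⟩
    filter_upwards [h, h'] with θ h h'
    refine ⟨by simp [h.1, h'.1], ?_⟩
    simp only [Pi.mul_apply, map_mul, h.2, h'.2]
    rw [div_mul_div_comm]
  one_mem' := ⟨1, 1, by simp⟩
  add_mem' := by
    rintro f g ⟨n, d, h⟩ ⟨n', d', h'⟩
    refine ⟨n * d' + d * n', d * d', ?_⟩
    filter_upwards [h, h'] with θ h h'
    refine ⟨by simp [h.1, h'.1], ?_⟩
    simp only [Pi.add_apply, map_mul, map_add, h.2, h'.2]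
    rw [div_add_div _ _ h.1 h'.1]
  zero_mem' := ⟨0, 1, by simp⟩
  neg_mem' := by
    rintro f ⟨n, d, h⟩
    refine ⟨-n, d, ?_⟩
    filter_upwards [h] with θ h
    exact ⟨h.1, by simp [h.2, neg_div]⟩

theorem rationalFunctions_congr {f g : Matrix V V ℝ × Matrix V V ℝ → ℝ}
    (hf : f ∈ G.rationalFunctions) (h : ∀ᶠ θ in G.generic, g θ = f θ) :
    g ∈ G.rationalFunctions := by
  obtain ⟨n, d, h'⟩ := hf
  exact ⟨n, d, by filter_upwards [h, h'] with θ h h' using ⟨h'.1, h.trans h'.2⟩⟩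

theorem rationalFunctions_inv {f : Matrix V V ℝ × Matrix V V ℝ → ℝ}
    (hf : f ∈ G.rationalFunctions) (h : ∀ᶠ θ in G.generic, f θ ≠ 0) :
    (fun θ => (f θ)⁻¹) ∈ G.rationalFunctions := by
  obtain ⟨n, d, h'⟩ := hf
  refine ⟨d, n, ?_⟩
  filter_upwards [h, h'] with θ h h'
  rw [h'.2] at h ⊢
  exact ⟨(div_ne_zero_iff.mp h).1, by rw [inv_div]⟩

theorem phi_mem_rationalFunctions (v w : V) :
    (fun θ => phi θ v w) ∈ G.rationalFunctions :=
  ⟨MvPolynomial.X (v, w), 1, by simp [entries]⟩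

theorem const_mem_rationalFunctions (c : ℝ) : (fun _ => c) ∈ G.rationalFunctions :=
  ⟨MvPolynomial.C c, 1, by simp⟩

theorem sum_mem_rationalFunctions {ι : Type*} (s : Finset ι)
    (f : ι → Matrix V V ℝ × Matrix V V ℝ → ℝ) (hf : ∀ i ∈ s, f i ∈ G.rationalFunctions) :
    (fun θ => ∑ i ∈ s, f i θ) ∈ G.rationalFunctions := by
  convert G.rationalFunctions.sum_mem hf using 1
  funext θ
  rw [Finset.sum_apply]

theorem det_mem_rationalFunctions {ι : Type*} [Fintype ι] [DecidableEq ι]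
    {M : Matrix V V ℝ × Matrix V V ℝ → Matrix ι ι ℝ}
    (hM : ∀ i j, (fun θ => M θ i j) ∈ G.rationalFunctions) :
    (fun θ => (M θ).det) ∈ G.rationalFunctions := by
  have h : (fun θ => (M θ).det) =
      (Matrix.of fun i j => (fun θ => M θ i j) : Matrix ι ι
        (Matrix V V ℝ × Matrix V V ℝ → ℝ)).det := by
    funext θ
    simp [Matrix.det_apply, Finset.sum_apply, Finset.prod_apply]
  rw [h, Matrix.det_apply]
  exact G.rationalFunctions.sum_mem fun σ _ => by
    rw [Units.smul_def]
    exact G.rationalFunctions.zsmul_mem (G.rationalFunctions.prod_mem fun i _ => hM _ _) _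

/-- Over the reals, AᵀA has the same kernel as A, so Cramer's rule applied to the normal equations
solves an overdetermined system without a choice of rows. -/
theorem mem_rationalFunctions_of_mulVec_eq {m n : Type*} [Fintype m] [Fintype n] [DecidableEq n]
    {A : Matrix V V ℝ × Matrix V V ℝ → Matrix m n ℝ} {b : Matrix V V ℝ × Matrix V V ℝ → m → ℝ}
    {x : Matrix V V ℝ × Matrix V V ℝ → n → ℝ}
    (hA : ∀ i j, (fun θ => A θ i j) ∈ G.rationalFunctions)
    (hb : ∀ i, (fun θ => b θ i) ∈ G.rationalFunctions)
    (hx : ∀ᶠ θ in G.generic, A θ *ᵥ x θ = b θ)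
    (hinj : ∀ᶠ θ in G.generic, ∀ c, A θ *ᵥ c = 0 → c = 0) (j : n) :
    (fun θ => x θ j) ∈ G.rationalFunctions := by
  have hM : ∀ i j, (fun θ => ((A θ).transpose * A θ) i j) ∈ G.rationalFunctions := fun i j => by
    simp only [Matrix.mul_apply, Matrix.transpose_apply]
    exact sum_mem_rationalFunctions _ _ fun k _ => G.rationalFunctions.mul_mem (hA k i) (hA k j)
  have hdet : ∀ᶠ θ in G.generic, ((A θ).transpose * A θ).det ≠ 0 := by
    filter_upwards [hinj] with θ hθ h0
    obtain ⟨c, hc, hc'⟩ := Matrix.exists_mulVec_eq_zero_iff.mpr h0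
    have : c ∈ LinearMap.ker ((A θ).transpose * A θ).mulVecLin := hc'
    rw [Matrix.ker_mulVecLin_transpose_mul_self] at this
    exact hc (hθ c this)
  have hadj : ∀ i j, (fun θ => ((A θ).transpose * A θ).adjugate i j) ∈ G.rationalFunctions := by
    intro i j
    simp only [Matrix.adjugate_apply]
    refine det_mem_rationalFunctions fun k l => ?_
    by_cases hk : k = j
    · subst hk
      simp only [Matrix.updateRow_self]
      exact const_mem_rationalFunctions _
    · simpa [Matrix.updateRow_ne hk] using hM k l
  have hsol : (fun θ => (((A θ).transpose * A θ).det)⁻¹ *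
      ∑ q, ((A θ).transpose * A θ).adjugate j q * ∑ w, A θ w q * b θ w) ∈
      G.rationalFunctions :=
    G.rationalFunctions.mul_mem (rationalFunctions_inv (det_mem_rationalFunctions hM) hdet)
      (sum_mem_rationalFunctions _ _ fun q _ => G.rationalFunctions.mul_mem (hadj j q)
        (sum_mem_rationalFunctions _ _ fun w _ => G.rationalFunctions.mul_mem (hA w q) (hb w)))
  refine rationalFunctions_congr hsol ?_
  filter_upwards [hx, hdet] with θ hx hdet
  have h1 : ((A θ).transpose * A θ).adjugate *ᵥ ((A θ).transpose *ᵥ b θ) =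
      ((A θ).transpose * A θ).det • x θ := by
    rw [← hx, Matrix.mulVec_mulVec (x θ), Matrix.mulVec_mulVec, Matrix.adjugate_mul,
      Matrix.smul_mulVec, Matrix.one_mulVec]
  have h2 := congrFun h1 j
  rw [eq_inv_mul_iff_mul_eq₀ hdet]
  simpa [Matrix.mulVec, dotProduct] using h2.symm

theorem one_sub_transpose_mul_phi {θ : Matrix V V ℝ × Matrix V V ℝ} (h : IsUnit (1 - θ.1)) :
    (1 - θ.1).transpose * phi θ = θ.2 * (1 - θ.1)⁻¹ := by
  have hu := (Matrix.isUnit_iff_isUnit_det _).mp h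
  rw [phi, ← mul_assoc, ← mul_assoc, ← Matrix.transpose_mul, Matrix.nonsing_inv_mul _ hu,
    Matrix.transpose_one, one_mul]

theorem phi_mul_one_sub {θ : Matrix V V ℝ × Matrix V V ℝ} (h : IsUnit (1 - θ.1)) :
    phi θ * (1 - θ.1) = ((1 - θ.1)⁻¹).transpose * θ.2 := by
  have hu := (Matrix.isUnit_iff_isUnit_det _).mp h
  rw [phi, mul_assoc, Matrix.nonsing_inv_mul _ hu, mul_one]

theorem one_sub_transpose_mul_phi_mul {θ : Matrix V V ℝ × Matrix V V ℝ} (h : IsUnit (1 - θ.1)) :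
    (1 - θ.1).transpose * phi θ * (1 - θ.1) = θ.2 := by
  have hu := (Matrix.isUnit_iff_isUnit_det _).mp h
  rw [one_sub_transpose_mul_phi h, mul_assoc, Matrix.nonsing_inv_mul _ hu, mul_one]

theorem one_sub_apply_eq_zero {θ : Matrix V V ℝ × Matrix V V ℝ} (hθ : θ ∈ G.Theta) {v u w : V}
    (hu : G.Reach v u) (hw : ¬ G.Reach v w) : (1 - θ.1) u w = 0 := by
  have h1 : u ≠ w := fun h => hw (h ▸ hu)
  simp [h1, hθ.1.1 u w fun h => hw (hu.trans_edge h)]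

/-- The set reachable from `v` is closed under outgoing edges, so I - Λ is block triangular for it
and its complement, and inversion preserves this. -/
theorem one_sub_inv_apply_eq_zero {θ : Matrix V V ℝ × Matrix V V ℝ} (hθ : θ ∈ G.Theta) {v u w : V}
    (hu : G.Reach v u) (hw : ¬ G.Reach v w) : (1 - θ.1)⁻¹ u w = 0 := by
  classical
  let b : V → ℕ := fun u => if G.Reach v u then 1 else 0
  have hb : ∀ i j, b j < b i ↔ G.Reach v i ∧ ¬ G.Reach v j := by
    intro i j
    simp only [b]
    split_ifs <;> simp_all
  have ht : (1 - θ.1).BlockTriangular b := fun i j hij =>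
    one_sub_apply_eq_zero hθ ((hb i j).mp hij).1 ((hb i j).mp hij).2
  have := hθ.1.2.invertible
  exact Matrix.blockTriangular_inv_of_blockTriangular ht ((hb u w).mpr ⟨hu, hw⟩)

/-- The matrix is (I - Λ)⁻ᵀΩ. Column `v` of Ω lives on `v` and its siblings, all reachable from `v`,
and the inverse does not lead from there to an unreachable node. -/
theorem phi_mul_one_sub_apply_eq_zero {θ : Matrix V V ℝ × Matrix V V ℝ} (hθ : θ ∈ G.Theta)
    {v w : V} (hw : ¬ G.Reach v w) : (phi θ * (1 - θ.1)) w v = 0 := by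
  rw [phi_mul_one_sub hθ.1.2, Matrix.mul_apply]
  refine Finset.sum_eq_zero fun u _ => ?_
  rw [Matrix.transpose_apply]
  by_cases hu : G.Reach v u
  · rw [one_sub_inv_apply_eq_zero hθ hu hw, zero_mul]
  · have := (not_reach_iff.mp hu).2
    rw [hθ.2.2 u v (fun h => this (Or.inl h)) (fun h => this (Or.inr h)), mul_zero]

/-- The incoming coefficients of a node are rational functions of the covariance matrix if those
of the half-trek reachable sources are. -/
theorem HalfTrekCriterion.mem_rationalFunctions {Y : Set V} {v : V}
    (h : G.HalfTrekCriterion Y v)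
    (hY : ∀ w ∈ Y ∩ G.htr v, ∀ u, (fun θ => θ.1 u w) ∈ G.rationalFunctions) (u : V) :
    (fun θ => θ.1 u v) ∈ G.rationalFunctions := by
  classical
  obtain ⟨hdisj, src, rfl, hlink⟩ := halfTrekCriterion_iff.mp h
  have hsrc : ∀ p, src p ∉ ({v} ∪ G.sib v : Set V) := fun p hp =>
    Set.notMem_empty _ (hdisj.subset ⟨⟨p, rfl⟩, hp⟩)
  by_cases hu : G.D u v
  swap
  · refine rationalFunctions_congr G.rationalFunctions.zero_mem ?_
    filter_upwards [eventually_mem_Theta] with θ hθ using hθ.1.1 u v hu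
  -- Every unreachable node contributes an equation, whether or not it is a source; the injectivity
  -- proof needs them all. Reachable nodes that are not sources get the trivial equation.
  let row : Matrix V V ℝ × Matrix V V ℝ → V → V → ℝ := fun θ w k =>
    if G.Reach v w then
      if w ∈ Set.range src then ((1 - θ.1).transpose * phi θ) w k else 0
    else phi θ w k
  have hrow : ∀ w k, (fun θ => row θ w k) ∈ G.rationalFunctions := by
    intro w k
    by_cases hr : G.Reach v w
    · by_cases hw : w ∈ Set.range src
      · simp only [row, hr, hw, if_true, Matrix.mul_apply, Matrix.transpose_apply,
          Matrix.sub_apply]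
        obtain ⟨p, rfl⟩ := hw
        refine sum_mem_rationalFunctions _ _ fun l _ => G.rationalFunctions.mul_mem
          (G.rationalFunctions.sub_mem (const_mem_rationalFunctions _) (hY _ ⟨⟨p, rfl⟩, mem_htr_iff.mpr ⟨hsrc p, hr⟩⟩ l))
          (phi_mem_rationalFunctions _ _)
      · simp only [row, hr, hw, if_true, if_false]
        exact G.rationalFunctions.zero_mem
    · simp only [row, hr, if_false]
      exact phi_mem_rationalFunctions _ _
  refine mem_rationalFunctions_of_mulVec_eq
    (A := fun θ => Matrix.of fun (w : V) (p : G.pa v) => row θ w p) (b := fun θ w => row θ w v)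
    (x := fun θ (p : G.pa v) => θ.1 p v) (fun w p => hrow w p) (fun w => hrow w v) ?_ ?_ ⟨u, hu⟩
  · filter_upwards [eventually_mem_Theta] with θ hθ
    funext w
    have hsum : ∀ f : V → ℝ, ∑ p : G.pa v, f p * θ.1 p v = ∑ k, f k * θ.1 k v := fun f =>
      Fintype.sum_of_injective (fun p : G.pa v => (p : V)) Subtype.val_injective _ _
        (fun k hk => by
          rw [hθ.1.1 k v fun h => hk ⟨⟨k, h⟩, rfl⟩, mul_zero]) fun _ => rfl
    simp only [Matrix.mulVec, dotProduct, Matrix.of_apply]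
    rw [hsum (row θ w)]
    have hmul : ∀ M : Matrix V V ℝ, (M * (1 - θ.1)) w v = 0 → ∑ k, M w k * θ.1 k v = M w v := by
      intro M hM
      rw [mul_sub, mul_one, Matrix.sub_apply, Matrix.mul_apply, sub_eq_zero] at hM
      exact hM.symm
    by_cases hr : G.Reach v w
    · by_cases hw : w ∈ Set.range src
      · simp only [row, hr, hw, if_true]
        refine hmul _ ?_
        rw [one_sub_transpose_mul_phi_mul hθ.1.2]
        obtain ⟨p, rfl⟩ := hw
        exact hθ.2.2 _ _ (fun h => hsrc p (Or.inl h)) fun h => hsrc p (Or.inr h)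
      · simp only [row, hr, hw, if_true, if_false, zero_mul, Finset.sum_const_zero]
    · simp only [row, hr, if_false]
      exact hmul _ (phi_mul_one_sub_apply_eq_zero hθ hr)
  · filter_upwards [eventually_mem_Theta, hlink.eventually_det_ne_zero] with θ hθ hdet c hc
    let c' : V → ℝ := fun k => if h : G.D k v then c ⟨k, h⟩ else 0
    have hc' : ∀ w, ∑ k, row θ w k * c' k = 0 := by
      intro w
      refine Eq.trans ?_ (congrFun hc w)
      refine (Fintype.sum_of_injective (fun p : G.pa v => (p : V)) Subtype.val_injective _ _
        (fun k hk => ?_) fun p => ?_).symm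
      · have h0 : c' k = 0 := dif_neg fun h => hk ⟨⟨k, h⟩, rfl⟩
        rw [h0, mul_zero]
      · have : G.D p v := p.2
        simp [c', this]
    have hphi : ∀ w, ¬ G.Reach v w → (phi θ *ᵥ c') w = 0 := fun w hw => by
      have := hc' w
      simp only [row, hw, if_false] at this
      exact this
    have hu := (Matrix.isUnit_iff_isUnit_det _).mp hθ.1.2
    -- Rows outside `pa v` return entries of `c'`, which vanish there. The others return entries of
    -- (I - Λ)ᵀΣc' at sources: at a reachable source this is an equation of the system, and at an
    -- unreachable one the entry combines only entries of Σc' at unreachable nodes, which are zero.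
    have hz : (linkMatrix src θ.1 θ.2) *ᵥ ((1 - θ.1)⁻¹ *ᵥ c') = 0 := by
      funext w
      by_cases hw : w ∈ G.pa v
      · have h1 : ((linkMatrix src θ.1 θ.2) *ᵥ ((1 - θ.1)⁻¹ *ᵥ c')) w =
            (((1 - θ.1).transpose * phi θ) *ᵥ c') (src ⟨w, hw⟩) := by
          rw [one_sub_transpose_mul_phi hθ.1.2, ← Matrix.mulVec_mulVec, Matrix.mulVec,
            linkMatrix_of_mem src _ _ ⟨w, hw⟩]
          rfl
        rw [h1]
        by_cases hr : G.Reach v (src ⟨w, hw⟩)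
        · have := hc' (src ⟨w, hw⟩)
          simp only [row, hr, if_true, Set.mem_range_self] at this
          exact this
        · rw [← Matrix.mulVec_mulVec]
          refine Finset.sum_eq_zero fun k _ => ?_
          change (1 - θ.1) k (src ⟨w, hw⟩) * (phi θ *ᵥ c') k = 0
          by_cases hk : G.Reach v k
          · rw [one_sub_apply_eq_zero hθ hk hr, zero_mul]
          · rw [hphi k hk, mul_zero]
      · have h1 : ((linkMatrix src θ.1 θ.2) *ᵥ ((1 - θ.1)⁻¹ *ᵥ c')) w =
            ((1 - θ.1) *ᵥ ((1 - θ.1)⁻¹ *ᵥ c')) w := by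
          rw [Matrix.mulVec, linkMatrix_of_notMem src _ _ hw]
          rfl
        rw [h1, Matrix.mulVec_mulVec, Matrix.mul_nonsing_inv _ hu, Matrix.one_mulVec]
        exact dif_neg hw
    have hz' : (1 - θ.1)⁻¹ *ᵥ c' = 0 := by
      by_contra hne
      exact hdet (Matrix.exists_mulVec_eq_zero_iff.mp ⟨_, hne, hz⟩)
    have hc0 : c' = 0 := by
      rw [← Matrix.one_mulVec c', ← Matrix.mul_nonsing_inv _ hu, ← Matrix.mulVec_mulVec, hz',
        Matrix.mulVec_zero]
    funext p
    have h1 := congrFun hc0 p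
    have h2 : G.D p v := p.2
    simpa [c', h2] using h1

theorem HTCIdentifiable.rationallyIdentifiable (h : G.HTCIdentifiable) :
    G.RationallyIdentifiable := by
  classical
  obtain ⟨Y, hY, r, hr, hord⟩ := h
  have hwf : WellFounded r := Finite.wellFounded_of_trans_of_irrefl r
  have hΛ : ∀ v u, (fun θ => θ.1 u v) ∈ G.rationalFunctions := fun v =>
    hwf.induction v fun v ih =>
      (hY v).mem_rationalFunctions fun w hw => ih w (hord v w hw)
  have hΩ : ∀ v w, (fun θ => θ.2 v w) ∈ G.rationalFunctions := by
    intro v w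
    have hM : ∀ a b, (fun θ => (1 - θ.1) a b) ∈ G.rationalFunctions := by
      intro a b
      exact G.rationalFunctions.sub_mem (const_mem_rationalFunctions _) (hΛ b a)
    have : (fun θ => ((1 - θ.1).transpose * phi θ * (1 - θ.1)) v w) ∈ G.rationalFunctions := by
      simp only [Matrix.mul_apply, Matrix.transpose_apply]
      exact sum_mem_rationalFunctions _ _ fun k _ => G.rationalFunctions.mul_mem
        (sum_mem_rationalFunctions _ _ fun l _ => G.rationalFunctions.mul_mem (hM _ _)
          (phi_mem_rationalFunctions _ _)) (hM _ _)
    refine rationalFunctions_congr this ?_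
    filter_upwards [eventually_mem_Theta] with θ hθ
    rw [one_sub_transpose_mul_phi_mul hθ.1.2]
  have hall : ∀ i : (V × V) ⊕ (V × V), (fun θ => pairEntries θ i) ∈ G.rationalFunctions := by
    rintro (⟨v, w⟩ | ⟨v, w⟩)
    · exact hΛ w v
    · exact hΩ v w
  choose n d hnd using hall
  obtain ⟨A, hA, hA'⟩ := exists_isProperAlgebraicSubset (eventually_all.mpr hnd)
  refine ⟨A, hA, ⟨n, d, fun i h0 => ?_⟩, fun θ hθ => ⟨fun i => (hA' θ hθ i).1,
    funext fun i => ((hA' θ hθ i).2).symm⟩⟩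
  obtain ⟨θ, hθ⟩ := (hnd i).exists
  exact hθ.1 (by simp [h0])

end Rational

end MixedGraph

/-! ### Maximal minors and block expansion of determinants. -/

namespace Matrix

/-- A matrix with trivial kernel over a domain has a maximal nonvanishing minor. -/
theorem exists_det_submatrix_ne_zero {R m n : Type*} [CommRing R] [IsDomain R] [Finite m]
    [Fintype n] [DecidableEq n] (J : Matrix m n R) (hJ : ∀ k, J *ᵥ k = 0 → k = 0) :
    ∃ r : n → m, (J.submatrix r id).det ≠ 0 := by
  cases nonempty_fintype m
  let K := FractionRing R
  have hinj : Function.Injective (algebraMap R K) := IsFractionRing.injective R K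
  have h1 : LinearIndependent R J.col := by
    rw [← mulVec_injective_iff]
    intro a b hab
    exact sub_eq_zero.mp (hJ _ (by
      have : J *ᵥ a = J *ᵥ b := hab
      rw [mulVec_sub, this, sub_self]))
  have h2 : LinearIndependent R (J.map (algebraMap R K)).col := by
    refine h1.map' ((Algebra.linearMap R K).compLeft m) ?_
    rw [LinearMap.ker_eq_bot]
    intro a b hab
    funext i
    exact hinj (congrFun hab i)
  have h3 : LinearIndependent K (J.map (algebraMap R K)).col :=
    (LinearIndependent.iff_fractionRing R K).mp h2
  have h4 : (J.map (algebraMap R K)).rank = Fintype.card n := by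
    rw [← rank_transpose]
    exact LinearIndependent.rank_matrix (M := (J.map (algebraMap R K))ᵀ) h3
  obtain ⟨κ, a, ha, hspan, hli⟩ := exists_linearIndependent' K (J.map (algebraMap R K)).row
  have := Finite.of_injective a ha
  cases nonempty_fintype κ
  have hcard : Fintype.card κ = Fintype.card n := by
    rw [linearIndependent_iff_card_eq_finrank_span.mp hli, Set.finrank, hspan,
      ← rank_eq_finrank_span_row, h4]
  let e : n ≃ κ := Fintype.equivOfCardEq hcard.symm
  refine ⟨a ∘ e, fun h0 => ?_⟩
  have h5 : LinearIndependent K ((J.submatrix (a ∘ e) id).map (algebraMap R K)).row :=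
    hli.comp e e.injective
  rw [linearIndependent_rows_iff_isUnit, isUnit_iff_isUnit_det, isUnit_iff_ne_zero] at h5
  refine h5 ?_
  change (RingHom.mapMatrix (algebraMap R K) (J.submatrix (a ∘ e) id)).det = 0
  rw [← RingHom.map_det, h0, map_zero]

/-- A consequence of Laplace expansion along blocks of columns: after a permutation of the rows,
the block diagonal part of a nonsingular matrix is nonsingular. -/
theorem exists_det_blocks_ne_zero {R ι γ : Type*} [CommRing R] [IsDomain R] [CharZero R]
    [Fintype ι] [DecidableEq ι] [DecidableEq γ] (f : ι → γ) (A : Matrix ι ι R) (hA : A.det ≠ 0) :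
    ∃ σ : Equiv.Perm ι, (of fun i j => if f i = f j then A (σ i) j else 0 : Matrix ι ι R).det ≠ 0
    := by
  by_contra! h
  -- Only permutations preserving the blocks contribute to the block diagonal determinants.
  -- Reindexing `σ` by `σ * τ` shows that each such `τ` contributes one full copy of `A.det` to the
  -- signed sum.
  let S : Finset (Equiv.Perm ι) := Finset.univ.filter fun τ => ∀ i, f (τ i) = f i
  have key : ∑ σ : Equiv.Perm ι, ((Equiv.Perm.sign σ : ℤ) : R) *
      (of fun i j => if f i = f j then A (σ i) j else 0 : Matrix ι ι R).det = S.card * A.det := by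
    calc _ = ∑ σ : Equiv.Perm ι, ∑ τ ∈ S, ((Equiv.Perm.sign (σ * τ) : ℤ) : R) *
          ∏ i, A ((σ * τ) i) i := by
          refine Finset.sum_congr rfl fun σ _ => ?_
          rw [det_apply', Finset.mul_sum, Finset.sum_filter]
          refine Finset.sum_congr rfl fun τ _ => ?_
          split_ifs with hτ
          · simp [hτ, mul_assoc]
          · push Not at hτ
            obtain ⟨i, hi⟩ := hτ
            rw [Finset.prod_eq_zero (Finset.mem_univ i) (by simp [hi]), mul_zero, mul_zero]
      _ = ∑ τ ∈ S, A.det := by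
          rw [Finset.sum_comm]
          refine Finset.sum_congr rfl fun τ _ => ?_
          rw [det_apply']
          exact Fintype.sum_equiv (Equiv.mulRight τ) _ _ fun σ => rfl
      _ = _ := by rw [Finset.sum_const, nsmul_eq_mul]
  rw [Finset.sum_eq_zero fun σ _ => by rw [h σ, mul_zero]] at key
  have hS : S.card ≠ 0 := Finset.card_ne_zero.mpr ⟨1, by simp [S]⟩
  exact (mul_ne_zero (Nat.cast_ne_zero.mpr hS) hA) key.symm

/-- A kernel vector of one diagonal block, extended by zero, is a kernel vector of the block
diagonal matrix. -/
theorem det_block_ne_zero {R ι γ κ : Type*} [CommRing R] [IsDomain R] [Fintype ι]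
    [DecidableEq ι] [DecidableEq γ] [Fintype κ] [DecidableEq κ] {f : ι → γ} {A : Matrix ι ι R}
    (hA : (of fun i j => if f i = f j then A i j else 0 : Matrix ι ι R).det ≠ 0)
    (c : γ) (e : κ ≃ {i // f i = c}) :
    (A.submatrix (fun k => (e k : ι)) fun k => (e k : ι)).det ≠ 0 := by
  intro h0
  obtain ⟨x, hx, hAx⟩ := exists_mulVec_eq_zero_iff.mpr h0
  let y : ι → R := fun i => if h : f i = c then x (e.symm ⟨i, h⟩) else 0
  have hy : ∀ k, y (e k) = x k := by
    intro k
    have := (e k).2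
    simp [y, this]
  refine hA (exists_mulVec_eq_zero_iff.mp ⟨y, fun h => hx (funext fun k => ?_), ?_⟩)
  · rw [← hy, h]
    rfl
  · funext i
    simp only [mulVec, dotProduct, of_apply, Pi.zero_apply]
    by_cases hi : f i = c
    · have h1 := congrFun hAx (e.symm ⟨i, hi⟩)
      simp only [mulVec, dotProduct, submatrix_apply, Pi.zero_apply, Equiv.apply_symm_apply]
        at h1
      rw [← h1]
      refine (Fintype.sum_of_injective (fun k => (e k : ι))
        (Subtype.val_injective.comp e.injective) _ _ (fun j hj => ?_) fun k => ?_).symm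
      · have hj' : f j ≠ c := fun h => hj ⟨e.symm ⟨j, h⟩, by simp⟩
        simp [y, hj']
      · rw [hy, if_pos (hi.trans (e k).2.symm)]
    · refine Finset.sum_eq_zero fun j _ => ?_
      split_ifs with h
      · have hj' : f j ≠ c := fun h' => hi (h.trans h')
        simp [y, hj']
      · rw [zero_mul]

theorem exists_perm_forall_ne_zero {R ι : Type*} [CommRing R] [IsDomain R] [Fintype ι]
    [DecidableEq ι] {A : Matrix ι ι R} (hA : A.det ≠ 0) :
    ∃ τ : Equiv.Perm ι, ∀ i, A i (τ i) ≠ 0 := by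
  rw [det_apply'] at hA
  obtain ⟨σ, -, hσ⟩ := Finset.exists_ne_zero_of_sum_ne_zero hA
  have h := Finset.prod_ne_zero_iff.mp (right_ne_zero_of_mul hσ)
  exact ⟨σ⁻¹, fun i => by simpa using h (σ⁻¹ i) (Finset.mem_univ _)⟩

end Matrix

/-! ### From nonsingular matrices back to half-trek systems. -/

namespace MixedGraph

section Linking

variable {V : Type*} {G : MixedGraph V}

/-- The directed path formed by the iterates of a map, up to an element of `P`. -/
theorem exists_diPath_iterate {P : Set V} {τ : V → V}
    (hτ : ∀ w ∉ P, τ w = w ∨ G.D w (τ w)) (k : ℕ) :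
    ∀ x, (∀ j < k, τ^[j] x ∉ P) →
      ∃ p : G.DiPath x (τ^[k] x), p.nodes ⊆ {y | ∃ j ≤ k, y = τ^[j] x} := by
  induction k with
  | zero =>
    intro x _
    refine ⟨.nil x, ?_⟩
    rintro y rfl
    exact ⟨0, le_rfl, rfl⟩
  | succ k ih =>
    intro x hx
    rcases hτ x (hx 0 (by omega)) with h | h
    · obtain ⟨q, hq⟩ := ih x fun j hj => hx j (by omega)
      rw [Function.iterate_succ_apply, h]
      exact ⟨q, fun y hy => (hq hy).imp fun j hj => ⟨by omega, hj.2⟩⟩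
    · obtain ⟨p, hp⟩ := ih (τ x) fun j hj => hx (j + 1) (by omega)
      refine ⟨.cons h p, ?_⟩
      rintro y (rfl | hy)
      · exact ⟨0, by omega, rfl⟩
      · obtain ⟨j, hj, rfl⟩ := hp hy
        exact ⟨j + 1, by omega, rfl⟩

/-- Cutting the cycles of `τ` at `P` gives disjoint directed paths from `τ p` to the first return to
`P`. The return map permutes `P`, hence the sources must be reassigned to the targets, with the same
range. -/
theorem exists_halfTrekLinking_of_perm [Finite V] {P : Set V} {src : P → V}
    (hsrc : Function.Injective src) (τ : Equiv.Perm V)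
    (hP : ∀ p : P, src p = τ p ∨ G.B (src p) (τ p))
    (hτ : ∀ w ∉ P, τ w = w ∨ G.D w (τ w)) :
    ∃ src' : P → V, Set.range src' = Set.range src ∧ G.HalfTrekLinking P src' := by
  classical
  have hret : ∀ p : P, ∃ k, τ^[k] (τ p) ∈ P := by
    intro p
    -- One application of `τ` is already spent in `τ p`; this many more lead back to `p`.
    refine ⟨orderOf τ - 1, ?_⟩
    have hpos : 0 < orderOf τ := orderOf_pos τ
    rw [← Function.iterate_succ_apply, Nat.succ_eq_add_one, Nat.sub_add_cancel hpos,
      ← Equiv.Perm.coe_pow, pow_orderOf_eq_one]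
    exact p.2
  let N : P → ℕ := fun p => Nat.find (hret p)
  have hN : ∀ p, τ^[N p] (τ p) ∈ P := fun p => Nat.find_spec (hret p)
  have hmin : ∀ p, ∀ j < N p, τ^[j] (τ p) ∉ P := fun p j hj => Nat.find_min (hret p) hj
  -- Cancelling `i + 1` applications of `τ` exhibits `p` as an iterate of `q`. Unless `p = q`, the
  -- path from `τ q` would have met `P` before its first return.
  have hmeet' : ∀ p q : P, ∀ i j, i ≤ j → j ≤ N q → τ^[i] (τ p) = τ^[j] (τ q) → p = q := by
    intro p q i j hij hj h
    obtain ⟨k, rfl⟩ := Nat.exists_eq_add_of_le hij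
    rw [← Function.iterate_succ_apply, ← Function.iterate_succ_apply,
      show (i + k).succ = (i + 1) + k by omega, Function.iterate_add_apply] at h
    have h1 := τ.injective.iterate _ h
    rcases k with - | k
    · exact Subtype.ext h1
    · rw [Function.iterate_succ_apply] at h1
      exact absurd (h1 ▸ p.2) (hmin q k (by omega))
  have hmeet : ∀ p q : P, ∀ i j, i ≤ N p → j ≤ N q → τ^[i] (τ p) = τ^[j] (τ q) → p = q := by
    intro p q i j hi hj h
    rcases le_total i j with hij | hij
    · exact hmeet' p q i j hij hj h
    · exact (hmeet' q p j i hij hi h.symm).symm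
  let r : P → P := fun p => ⟨τ^[N p] (τ p), hN p⟩
  have hr : Function.Injective r := fun p q h =>
    hmeet p q _ _ le_rfl le_rfl (congrArg Subtype.val h)
  let e : P ≃ P := Equiv.ofBijective r (Finite.injective_iff_bijective.mp hr)
  have hpath : ∀ p' : P, ∃ p : G.DiPath (τ (e.symm p')) p',
      p.nodes ⊆ {y | ∃ j ≤ N (e.symm p'), y = τ^[j] (τ (e.symm p'))} := by
    intro p'
    obtain ⟨q, rfl⟩ := e.surjective p'
    rw [Equiv.symm_apply_apply]
    exact exists_diPath_iterate hτ (N q) (τ q) (hmin q)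
  choose path hnodes using hpath
  refine ⟨src ∘ e.symm, e.symm.surjective.range_comp src, hsrc.comp e.symm.injective,
    fun p => τ (e.symm p), path, fun p => hP _, fun p q hpq => ?_⟩
  rw [Set.disjoint_left]
  intro y hy hy'
  obtain ⟨i, hi, rfl⟩ := hnodes p hy
  obtain ⟨j, hj, h⟩ := hnodes q hy'
  exact hpq (e.symm.injective (hmeet _ _ i j hi hj h))

variable [Fintype V] [DecidableEq V]

/-- If `z` is in the kernel of the link matrix, then (I - Λ)z is supported on `P` and is killed by
the given minor's matrix. The adjugate replaces the inverse, so the argument works over a domain. -/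
theorem det_linkMatrix_ne_zero {R : Type*} [CommRing R] [IsDomain R] {P : Set V} [Fintype P]
    {src : P → V} {Λ Ω : Matrix V V R} (hΛ : (1 - Λ).det ≠ 0)
    (h : ((Ω * (1 - Λ).adjugate).submatrix src Subtype.val : Matrix P P R).det ≠ 0) :
    (linkMatrix src Λ Ω).det ≠ 0 := by
  intro h0
  obtain ⟨z, hz, hKz⟩ := Matrix.exists_mulVec_eq_zero_iff.mpr h0
  have h1 : ∀ w ∉ P, ((1 - Λ) *ᵥ z) w = 0 := by
    intro w hw
    have := congrFun hKz w
    rwa [Matrix.mulVec, linkMatrix_of_notMem src Λ Ω hw] at this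
  have h2 : ∀ p, (Ω *ᵥ z) (src p) = 0 := by
    intro p
    have := congrFun hKz p
    rwa [Matrix.mulVec, linkMatrix_of_mem] at this
  have h3 : (1 - Λ).adjugate *ᵥ ((1 - Λ) *ᵥ z) = (1 - Λ).det • z := by
    rw [Matrix.mulVec_mulVec, Matrix.adjugate_mul, Matrix.smul_mulVec, Matrix.one_mulVec]
  have h4 : (fun p : P => ((1 - Λ) *ᵥ z) (p : V)) = 0 := by
    by_contra hne
    refine h (Matrix.exists_mulVec_eq_zero_iff.mp ⟨_, hne, funext fun p => ?_⟩)
    have h5 : ((Ω * (1 - Λ).adjugate) *ᵥ ((1 - Λ) *ᵥ z)) (src p) = 0 := by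
      rw [← Matrix.mulVec_mulVec, h3, Matrix.mulVec_smul, Pi.smul_apply, h2, smul_zero]
    refine Eq.trans ?_ h5
    refine Fintype.sum_of_injective (fun p : P => (p : V)) Subtype.val_injective _ _
      (fun k hk => ?_) fun _ => rfl
    rw [h1 k fun h => hk ⟨⟨k, h⟩, rfl⟩, mul_zero]
  have h6 : (1 - Λ) *ᵥ z = 0 := by
    funext w
    by_cases hw : w ∈ P
    · exact congrFun h4 ⟨w, hw⟩
    · exact h1 w hw
  rw [h6, Matrix.mulVec_zero] at h3
  exact hz ((smul_eq_zero.mp h3.symm).resolve_left hΛ)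

theorem exists_halfTrekLinking_of_det_ne_zero {R : Type*} [CommRing R] [IsDomain R] {P : Set V}
    {src : P → V} (hsrc : Function.Injective src) {Λ Ω : Matrix V V R}
    (hΛ : ∀ v w, ¬ G.D v w → Λ v w = 0) (hΩ : ∀ v w, v ≠ w → ¬ G.B v w → Ω v w = 0)
    (h : (linkMatrix src Λ Ω).det ≠ 0) :
    ∃ src' : P → V, Set.range src' = Set.range src ∧ G.HalfTrekLinking P src' := by
  obtain ⟨τ, hτ⟩ := Matrix.exists_perm_forall_ne_zero h
  refine exists_halfTrekLinking_of_perm hsrc τ (fun p => ?_) fun w hw => ?_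
  · have := hτ p
    rw [linkMatrix_of_mem] at this
    by_contra! hcon
    exact this (hΩ _ _ hcon.1 hcon.2)
  · have := hτ w
    rw [linkMatrix_of_notMem src Λ Ω hw] at this
    by_contra! hcon
    exact this (by simp [hcon.1.symm, hΛ _ _ hcon.2])

open Classical in
variable (G) in
/-- The matrix of the linear system for the tangent directions along which the covariance matrix
is constant. Rows are indexed by pairs of nodes and columns by directed edges. -/
noncomputable def tangentMatrix {R : Type*} [CommRing R] (Λ Ω : Matrix V V R) :
    Matrix (V × V) {e : V × V // G.D e.1 e.2} R :=
  Matrix.of fun a e => if a.1 ≠ a.2 ∧ ¬ G.B a.1 a.2 then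
    (if e.1.2 = a.1 then (Ω * (1 - Λ).adjugate) a.2 e.1.1 else 0) +
    (if e.1.2 = a.2 then (Ω * (1 - Λ).adjugate) a.1 e.1.1 else 0) else 0

theorem tangentMatrix_swap {R : Type*} [CommRing R] (Λ Ω : Matrix V V R) (a : V × V)
    (e : {e : V × V // G.D e.1 e.2}) :
    G.tangentMatrix Λ Ω a.swap e = G.tangentMatrix Λ Ω a e := by
  have h : G.B a.2 a.1 ↔ G.B a.1 a.2 := ⟨G.B_symm _ _, G.B_symm _ _⟩
  classical
  exact if_congr (by rw [Prod.fst_swap, Prod.snd_swap, ne_comm, h]) (add_comm _ _) rfl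

/-- A nonzero maximal minor, expanded along the blocks of edges with common head, assigns to each
`v` as many rows as it has parents. Each such row is a nonadjacent pair (in the bidirected sense)
containing `v`, and the other members of these pairs form the set for `v`. No pair is used twice,
which rules out mutual membership. -/
theorem not_HTCInfiniteToOne [Fintype {e : V × V // G.D e.1 e.2}]
    {R : Type*} [CommRing R] [IsDomain R] [CharZero R]
    {Λ Ω : Matrix V V R} (hΛ : ∀ v w, ¬ G.D v w → Λ v w = 0)
    (hΩ : ∀ v w, v ≠ w → ¬ G.B v w → Ω v w = 0) (hdet : (1 - Λ).det ≠ 0)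
    (hker : ∀ k, G.tangentMatrix Λ Ω *ᵥ k = 0 → k = 0) : ¬ G.HTCInfiniteToOne := by
  classical
  obtain ⟨r, hr⟩ := Matrix.exists_det_submatrix_ne_zero _ hker
  obtain ⟨σ, hσ⟩ := Matrix.exists_det_blocks_ne_zero
    (fun e : {e : V × V // G.D e.1 e.2} => e.1.2) _ hr
  -- Swapped pairs index equal rows, so a nonzero minor uses distinct unordered pairs.
  have hrinj : ∀ e e', r e = r e' ∨ r e = (r e').swap → e = e' := by
    intro e e' h
    by_contra hne
    refine hr (Matrix.det_zero_of_row_eq hne (funext fun k => ?_))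
    rcases h with h | h
    · simp only [Matrix.submatrix_apply, h]
    · simp only [Matrix.submatrix_apply, h, tangentMatrix_swap]
  let edge : ∀ v, G.pa v → {e : V × V // G.D e.1 e.2} := fun v p => ⟨(p, v), p.2⟩
  let eqv : ∀ v, G.pa v ≃ {e : {e : V × V // G.D e.1 e.2} // e.1.2 = v} := fun v =>
    { toFun := fun p => ⟨edge v p, rfl⟩
      invFun := fun e => ⟨e.1.1.1, by
        have h1 := e.1.2
        rw [e.2] at h1
        exact h1⟩
      left_inv := fun p => rfl
      right_inv := by
        rintro ⟨⟨⟨a, b⟩, h⟩, rfl⟩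
        rfl }
  let ρ : ∀ v, G.pa v → V × V := fun v p => r (σ (edge v p))
  have hblock : ∀ v, (Matrix.of fun p q : G.pa v =>
      G.tangentMatrix Λ Ω (ρ v p) (edge v q) : Matrix _ _ R).det ≠ 0 := fun v =>
    Matrix.det_block_ne_zero (A := Matrix.of fun i j => G.tangentMatrix Λ Ω (r (σ i)) j) hσ v
      (eqv v)
  have hrow : ∀ v p, ∃ q, G.tangentMatrix Λ Ω (ρ v p) (edge v q) ≠ 0 := by
    intro v p
    by_contra! h
    exact hblock v (Matrix.det_eq_zero_of_row_eq_zero p fun q => h q)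
  have hρ : ∀ v p, ((ρ v p).1 ≠ (ρ v p).2 ∧ ¬ G.B (ρ v p).1 (ρ v p).2) ∧
      (v = (ρ v p).1 ∨ v = (ρ v p).2) := by
    intro v p
    obtain ⟨q, hq⟩ := hrow v p
    by_contra hcon
    refine hq ?_
    rcases not_and_or.mp hcon with h | h
    · exact if_neg h
    · obtain ⟨h1, h2⟩ := not_or.mp h
      simp [tangentMatrix, edge, h1, h2]
  let src : ∀ v, G.pa v → V := fun v p => if v = (ρ v p).1 then (ρ v p).2 else (ρ v p).1
  have hsrc : ∀ v p, ρ v p = (v, src v p) ∨ ρ v p = (src v p, v) := by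
    intro v p
    simp only [src]
    split_ifs with h
    · exact Or.inl (Prod.ext h.symm rfl)
    · exact Or.inr (Prod.ext rfl ((hρ v p).2.resolve_left h).symm)
  have hsib : ∀ v p, src v p ≠ v ∧ ¬ G.B (src v p) v := by
    intro v p
    obtain ⟨⟨h1, h2⟩, -⟩ := hρ v p
    rcases hsrc v p with h | h
    · rw [h] at h1 h2
      exact ⟨h1.symm, fun h' => h2 (G.B_symm _ _ h')⟩
    · rw [h] at h1 h2
      exact ⟨h1, h2⟩
  have hval : ∀ v p q, G.tangentMatrix Λ Ω (ρ v p) (edge v q) =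
      (Ω * (1 - Λ).adjugate) (src v p) q := by
    intro v p q
    have h1 := (hsib v p).1
    have h2 := (hsib v p).2
    have h3 : ¬ G.B v (src v p) := fun h => h2 (G.B_symm _ _ h)
    rcases hsrc v p with h | h
    · rw [h]
      simp [tangentMatrix, edge, h1.symm, h3]
    · rw [h]
      simp [tangentMatrix, edge, h1, h1.symm, h2]
  have hsub : ∀ v, ((Ω * (1 - Λ).adjugate).submatrix (src v) Subtype.val :
      Matrix (G.pa v) (G.pa v) R).det ≠ 0 := by
    intro v
    have := hblock v
    simp only [hval] at this
    exact this
  have hinj : ∀ v, Function.Injective (src v) := by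
    intro v p q hpq
    by_contra hne
    exact hsub v (Matrix.det_zero_of_row_eq hne (funext fun k => by
      simp only [Matrix.submatrix_apply, hpq]))
  intro hinf
  rcases hinf fun v => Set.range (src v) with ⟨v, hv⟩ | ⟨v, w, hvw, ⟨p, hp⟩, ⟨q, hq⟩⟩
  · obtain ⟨src', h1, h2⟩ := exists_halfTrekLinking_of_det_ne_zero (hinj v) hΛ hΩ
      (det_linkMatrix_ne_zero hdet (hsub v))
    refine hv (halfTrekCriterion_iff.mpr ⟨?_, src', h1, h2⟩)
    rw [← Set.disjoint_iff_inter_eq_empty, Set.disjoint_left]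
    rintro _ ⟨p, rfl⟩ (h | h)
    · exact (hsib v p).1 h
    · exact (hsib v p).2 h
  · have h1 := hsrc w p
    have h2 := hsrc v q
    rw [hp] at h1
    rw [hq] at h2
    have h3 : ρ w p = ρ v q ∨ ρ w p = (ρ v q).swap := by
      rcases h1 with h1 | h1 <;> rcases h2 with h2 | h2 <;> simp [h1, h2]
    have h4 := σ.injective (hrinj _ _ h3)
    exact hvw (congrArg (fun e => e.1.2) h4).symm

end Linking

end MixedGraph

/-! ### Integral curves and derivatives of matrix functions. -/

namespace MvPolynomial

/-- Local integral curves of polynomial vector fields. -/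
theorem exists_integralCurve {σ : Type*} [Fintype σ] (F : σ → MvPolynomial σ ℝ) (x₀ : σ → ℝ) :
    ∃ α : ℝ → σ → ℝ, α 0 = x₀ ∧ ∃ ε > 0, ∀ t ∈ Set.Ioo (-ε) ε,
      ∀ i, HasDerivAt (fun s => α s i) (eval (α t) (F i)) t := by
  have hF : ContDiff ℝ 1 fun x : σ → ℝ => fun i => eval x (F i) := by
    rw [contDiff_pi]
    intro i
    exact (AnalyticOnNhd.eval_mvPolynomial (F i)).contDiff
  obtain ⟨α, h0, ε, hε, hα⟩ :=
    hF.contDiffAt.exists_forall_mem_closedBall_exists_eq_forall_mem_Ioo_hasDerivAt₀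
      (x₀ := x₀) 0
  refine ⟨α, h0, ε, hε, fun t ht i => ?_⟩
  exact hasDerivAt_pi.mp (hα t (by simpa using ht)) i

end MvPolynomial

namespace Matrix

variable {m n p : Type*}

theorem hasDerivAt_mul_apply [Fintype n] {A : ℝ → Matrix m n ℝ} {B : ℝ → Matrix n p ℝ}
    {A' : Matrix m n ℝ} {B' : Matrix n p ℝ} {t : ℝ}
    (hA : ∀ i j, HasDerivAt (fun s => A s i j) (A' i j) t)
    (hB : ∀ i j, HasDerivAt (fun s => B s i j) (B' i j) t) (i : m) (j : p) :
    HasDerivAt (fun s => (A s * B s) i j) ((A' * B t + A t * B') i j) t := by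
  simp only [mul_apply, add_apply, ← Finset.sum_add_distrib]
  exact HasDerivAt.fun_sum fun k _ => (hA i k).mul (hB k j)

theorem differentiableAt_det [Fintype n] [DecidableEq n] {A : ℝ → Matrix n n ℝ} {t : ℝ}
    (hA : ∀ i j, DifferentiableAt ℝ (fun s => A s i j) t) :
    DifferentiableAt ℝ (fun s => (A s).det) t := by
  simp only [det_apply']
  exact DifferentiableAt.fun_sum fun σ _ =>
    (differentiableAt_const _).mul (DifferentiableAt.fun_finsetProd fun i _ => hA _ _)

theorem differentiableAt_inv_apply [Fintype n] [DecidableEq n] {A : ℝ → Matrix n n ℝ} {t : ℝ}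
    (hA : ∀ i j, DifferentiableAt ℝ (fun s => A s i j) t) (h : (A t).det ≠ 0) (i j : n) :
    DifferentiableAt ℝ (fun s => (A s)⁻¹ i j) t := by
  simp only [inv_def, smul_apply, smul_eq_mul, Ring.inverse_eq_inv', adjugate_apply]
  refine ((differentiableAt_det hA).inv h).mul (differentiableAt_det fun k l => ?_)
  by_cases hk : k = j
  · subst hk
    simp
  · simpa [updateRow_ne hk] using hA k l

theorem hasDerivAt_inv_apply [Fintype n] [DecidableEq n] {A : ℝ → Matrix n n ℝ}
    {A' : Matrix n n ℝ} {t : ℝ} (hA : ∀ i j, HasDerivAt (fun s => A s i j) (A' i j) t)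
    (h : ∀ᶠ s in 𝓝 t, (A s).det ≠ 0) (i j : n) :
    HasDerivAt (fun s => (A s)⁻¹ i j) (-((A t)⁻¹ * A' * (A t)⁻¹) i j) t := by
  have ht := h.self_of_nhds
  let D : Matrix n n ℝ := of fun i j => deriv (fun s => (A s)⁻¹ i j) t
  have hD : ∀ i j, HasDerivAt (fun s => (A s)⁻¹ i j) (D i j) t := fun i j =>
    (differentiableAt_inv_apply (fun i j => (hA i j).differentiableAt) ht i j).hasDerivAt
  have h1 : A' * (A t)⁻¹ + A t * D = 0 := by
    ext k l
    refine (hasDerivAt_mul_apply hA hD k l).unique ?_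
    refine (hasDerivAt_const t ((1 : Matrix n n ℝ) k l)).congr_of_eventuallyEq ?_
    filter_upwards [h] with s hs
    rw [mul_nonsing_inv _ (isUnit_iff_ne_zero.mpr hs)]
  have h2 : D = -((A t)⁻¹ * A' * (A t)⁻¹) := by
    have h3 := congrArg ((A t)⁻¹ * ·) h1
    simp only [mul_add, mul_zero, ← mul_assoc,
      nonsing_inv_mul _ (isUnit_iff_ne_zero.mpr ht), one_mul] at h3
    exact (neg_eq_of_add_eq_zero_right h3).symm
  have h4 := hD i j
  rw [h2] at h4
  exact h4

end Matrix

theorem eq_of_forall_hasDerivAt_zero {f : ℝ → ℝ} {ε : ℝ} (hε : 0 < ε)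
    (hf : ∀ t ∈ Set.Ioo (-ε) ε, HasDerivAt f 0 t) {t : ℝ} (ht : t ∈ Set.Ioo (-ε) ε) :
    f t = f 0 :=
  isOpen_Ioo.is_const_of_deriv_eq_zero isPreconnected_Ioo
    (fun s hs => (hf s hs).differentiableAt.differentiableWithinAt)
    (fun s hs => (hf s hs).deriv) ht ⟨by linarith, hε⟩

namespace MixedGraph

section Curves

variable {V : Type*} [Fintype V] [DecidableEq V] {G : MixedGraph V}

/-- With X = (I - Λ)⁻¹, whose derivative is XΛ'X, the derivative of XᵀΩX is Xᵀ((XΛ')ᵀΩ + Ω' +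
ΩXΛ')X. -/
theorem hasDerivAt_phi_apply {θ : ℝ → Matrix V V ℝ × Matrix V V ℝ} {Λ' Ω' : Matrix V V ℝ} {t : ℝ}
    (hΛ : ∀ i j, HasDerivAt (fun s => (θ s).1 i j) (Λ' i j) t)
    (hΩ : ∀ i j, HasDerivAt (fun s => (θ s).2 i j) (Ω' i j) t)
    (hdet : ∀ᶠ s in 𝓝 t, (1 - (θ s).1).det ≠ 0)
    (h : ((1 - (θ t).1)⁻¹ * Λ')ᵀ * (θ t).2 + Ω' + (θ t).2 * ((1 - (θ t).1)⁻¹ * Λ') = 0)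
    (i j : V) : HasDerivAt (fun s => phi (θ s) i j) 0 t := by
  have hM : ∀ i j, HasDerivAt (fun s => (1 - (θ s).1) i j) ((-Λ') i j) t := fun i j =>
    (hΛ i j).const_sub _
  have hX := Matrix.hasDerivAt_inv_apply hM hdet
  set X := (1 - (θ t).1)⁻¹ with hXdef
  have hX' : ∀ i j, HasDerivAt (fun s => (1 - (θ s).1)⁻¹ i j) ((X * Λ' * X) i j) t := fun i j => by
    simpa using hX i j
  have hXT : ∀ i j, HasDerivAt (fun s => ((1 - (θ s).1)⁻¹)ᵀ i j) ((X * Λ' * X)ᵀ i j) t :=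
    fun i j => hX' j i
  have key := Matrix.hasDerivAt_mul_apply (Matrix.hasDerivAt_mul_apply hXT hΩ) hX' i j
  have hzero : ((X * Λ' * X)ᵀ * (θ t).2 + Xᵀ * Ω') * X + Xᵀ * (θ t).2 * (X * Λ' * X) = 0 := by
    have : ((X * Λ' * X)ᵀ * (θ t).2 + Xᵀ * Ω') * X + Xᵀ * (θ t).2 * (X * Λ' * X) =
        Xᵀ * ((X * Λ')ᵀ * (θ t).2 + Ω' + (θ t).2 * (X * Λ')) * X := by
      rw [Matrix.transpose_mul (X * Λ') X]
      noncomm_ring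
    rw [this, h, mul_zero, zero_mul]
  rw [← hXdef, hzero] at key
  exact key

end Curves

end MixedGraph

/-! ### Polynomial tangent directions. -/

namespace MixedGraph

section Projection

variable {V : Type*} [Fintype V] [DecidableEq V] (G : MixedGraph V)

open Classical in
/-- The projection of the space of all pairs of matrices, in coordinates, onto the linear space
spanned by the parameter space. -/
noncomputable def project (a : (V × V) ⊕ (V × V) → ℝ) : Matrix V V ℝ × Matrix V V ℝ :=
  (Matrix.of fun v w => if G.D v w then a (Sum.inl (v, w)) else 0,
    Matrix.of fun v w => if v = w ∨ G.B v w then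
      (1 / 2) * (a (Sum.inr (v, w)) + a (Sum.inr (w, v))) else 0)

open Classical in
/-- The projection as a substitution of polynomials. -/
noncomputable def projectHom : MvPolynomial ((V × V) ⊕ (V × V)) ℝ →ₐ[ℝ]
    MvPolynomial ((V × V) ⊕ (V × V)) ℝ :=
  MvPolynomial.aeval <| Sum.elim
    (fun e => if G.D e.1 e.2 then MvPolynomial.X (Sum.inl e) else 0)
    (fun e => if e.1 = e.2 ∨ G.B e.1 e.2 then MvPolynomial.C (1 / 2) *
      (MvPolynomial.X (Sum.inr e) + MvPolynomial.X (Sum.inr e.swap)) else 0)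

variable {G}

omit [Fintype V] in
theorem eval_projectHom (a : (V × V) ⊕ (V × V) → ℝ) (p : MvPolynomial ((V × V) ⊕ (V × V)) ℝ) :
    MvPolynomial.eval a (G.projectHom p) = MvPolynomial.eval (pairEntries (G.project a)) p := by
  have h : (MvPolynomial.aeval a).comp G.projectHom =
      MvPolynomial.aeval (R := ℝ) (pairEntries (G.project a)) := by
    refine MvPolynomial.algHom_ext fun i => ?_
    rcases i with ⟨v, w⟩ | ⟨v, w⟩
    · simp only [projectHom, AlgHom.comp_apply, MvPolynomial.aeval_X, Sum.elim_inl, pairEntries,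
        entries, project, Matrix.of_apply]
      split_ifs <;> simp
    · simp only [projectHom, AlgHom.comp_apply, MvPolynomial.aeval_X, Sum.elim_inr, pairEntries,
        entries, project, Matrix.of_apply]
      split_ifs <;> simp
  exact DFunLike.congr_fun h p

omit [Fintype V] in
theorem project_mem_support (a : (V × V) ⊕ (V × V) → ℝ) : G.project a ∈ G.support := by
  refine ⟨fun v w h => by simp [project, h], ?_, fun v w h h' => by simp [project, h, h']⟩
  ext v w
  have h : G.B w v ↔ G.B v w := ⟨G.B_symm _ _, G.B_symm _ _⟩
  classical
  exact if_congr (by rw [h, eq_comm]) (by rw [add_comm]) rfl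

omit [Fintype V] in
theorem project_pairEntries {θ : Matrix V V ℝ × Matrix V V ℝ} (h : θ ∈ G.support) :
    G.project (pairEntries θ) = θ := by
  refine Prod.ext ?_ ?_
  · ext v w
    by_cases hD : G.D v w
    · simp [project, pairEntries, entries, hD]
    · simp [project, hD, h.1 v w hD]
  · ext v w
    by_cases hB : v = w ∨ G.B v w
    · simp only [project, pairEntries, entries, hB, if_true, Matrix.of_apply, Sum.elim_inr]
      rw [h.2.1.apply v w]
      ring
    · obtain ⟨h1, h2⟩ := not_or.mp hB
      simp [project, hB, h.2.2 v w h1 h2]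

theorem map_tangentMatrix {R S : Type*} [CommRing R] [CommRing S] (φ : R →+* S)
    (Λ Ω : Matrix V V R) :
    (G.tangentMatrix Λ Ω).map φ = G.tangentMatrix (Λ.map φ) (Ω.map φ) := by
  have h : (Ω * (1 - Λ).adjugate).map φ = Ω.map φ * (1 - Λ.map φ).adjugate := by
    rw [Matrix.map_mul, ← RingHom.mapMatrix_apply φ (1 - Λ).adjugate, RingHom.map_adjugate,
      RingHom.mapMatrix_apply, Matrix.map_sub _ (map_sub φ),
      Matrix.map_one _ (map_zero φ) (map_one φ)]
  ext a e
  simp only [tangentMatrix, ← h, Matrix.map_apply, Matrix.of_apply]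
  split_ifs <;> simp

/-- If the graph is HTC-infinite-to-one, there is a polynomial tangent direction along which the
covariance matrix is constant. -/
theorem HTCInfiniteToOne.exists_kernel [Fintype {e : V × V // G.D e.1 e.2}]
    (h : G.HTCInfiniteToOne) :
    ∃ κ : {e : V × V // G.D e.1 e.2} → MvPolynomial ((V × V) ⊕ (V × V)) ℝ,
      (∀ θ ∈ G.support, G.tangentMatrix θ.1 θ.2 *ᵥ
        (fun e => MvPolynomial.eval (pairEntries θ) (κ e)) = 0) ∧
      ∃ e, ∃ η ∈ G.support, MvPolynomial.eval (pairEntries η) (κ e) ≠ 0 := by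
  -- This subring of the polynomial ring is a domain of characteristic zero containing a generic
  -- point of the support space. Its elements are determined by their values on that space.
  let R := G.projectHom.range
  let gen : (V × V) ⊕ (V × V) → R := fun i => G.projectHom.rangeRestrict (MvPolynomial.X i)
  let Λ : Matrix V V R := Matrix.of fun v w => gen (Sum.inl (v, w))
  let Ω : Matrix V V R := Matrix.of fun v w => gen (Sum.inr (v, w))
  have hchar : CharZero R :=
    charZero_of_injective_algebraMap (algebraMap ℝ R).injective
  let ev : ((V × V) ⊕ (V × V) → ℝ) → R →+* ℝ := fun a =>
    (MvPolynomial.eval a).comp R.val.toRingHom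
  have hev : ∀ a p, ev a (G.projectHom.rangeRestrict p) =
      MvPolynomial.eval (pairEntries (G.project a)) p := fun a p => eval_projectHom a p
  have hΛev : ∀ a, Λ.map (ev a) = (G.project a).1 := by
    intro a
    ext v w
    simp only [Λ, gen, Matrix.map_apply, Matrix.of_apply]
    rw [hev]
    simp [pairEntries, entries]
  have hΩev : ∀ a, Ω.map (ev a) = (G.project a).2 := by
    intro a
    ext v w
    simp only [Ω, gen, Matrix.map_apply, Matrix.of_apply]
    rw [hev]
    simp [pairEntries, entries]
  have hΛ : ∀ v w, ¬ G.D v w → Λ v w = 0 := fun v w hvw => Subtype.ext <| by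
    change G.projectHom (MvPolynomial.X _) = 0
    rw [projectHom, MvPolynomial.aeval_X]
    exact if_neg hvw
  have hΩ : ∀ v w, v ≠ w → ¬ G.B v w → Ω v w = 0 := fun v w hvw hB => Subtype.ext <| by
    change G.projectHom (MvPolynomial.X _) = 0
    rw [projectHom, MvPolynomial.aeval_X]
    exact if_neg (not_or.mpr ⟨hvw, hB⟩)
  have hdet : (1 - Λ).det ≠ 0 := by
    intro h0
    have h1 := congrArg (ev 0) h0
    rw [RingHom.map_det, RingHom.mapMatrix_apply, Matrix.map_sub _ (map_sub _),
      Matrix.map_one _ (map_zero _) (map_one _), hΛev, map_zero] at h1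
    have h2 : (G.project (0 : (V × V) ⊕ (V × V) → ℝ)).1 = 0 := by
      ext v w
      simp [project]
    rw [h2] at h1
    simp at h1
  have hker : ∃ k, G.tangentMatrix Λ Ω *ᵥ k = 0 ∧ k ≠ 0 := by
    by_contra! hcon
    exact not_HTCInfiniteToOne hΛ hΩ hdet hcon h
  obtain ⟨k, hk, hk0⟩ := hker
  choose κ hκ using fun e => G.projectHom.rangeRestrict_surjective (k e)
  refine ⟨κ, fun θ hθ => ?_, ?_⟩
  · have h1 : (fun e => MvPolynomial.eval (pairEntries θ) (κ e)) = ev (pairEntries θ) ∘ k := by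
      funext e
      rw [Function.comp_apply, ← hκ, hev, project_pairEntries hθ]
    have h2 : G.tangentMatrix θ.1 θ.2 = (G.tangentMatrix Λ Ω).map (ev (pairEntries θ)) := by
      rw [map_tangentMatrix, hΛev, hΩev, project_pairEntries hθ]
    rw [h1, h2]
    funext a
    rw [← RingHom.map_mulVec, hk]
    simp
  · obtain ⟨e, he⟩ := Function.ne_iff.mp hk0
    by_contra! hcon
    refine he (Subtype.ext (MvPolynomial.funext fun a => ?_))
    have h3 := hcon e (G.project a) (project_mem_support a)
    rw [← eval_projectHom] at h3
    rw [← hκ]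
    simpa using h3

/-- Identifies the kernel equations with the vanishing of W + Wᵀ at the entries where Ω must stay
zero. -/
theorem tangentMatrix_mulVec [Fintype {e : V × V // G.D e.1 e.2}] {R : Type*} [CommRing R]
    (Λ Ω : Matrix V V R) (K : Matrix V V R) (hK : ∀ u v, ¬ G.D u v → K u v = 0) {v w : V}
    (hvw : v ≠ w) (hB : ¬ G.B v w) :
    (G.tangentMatrix Λ Ω *ᵥ fun e => K e.1.1 e.1.2) (v, w) =
      (Ω * (1 - Λ).adjugate * K) w v + (Ω * (1 - Λ).adjugate * K) v w := by
  classical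
  have key : ∀ x y : V, ∑ e : {e : V × V // G.D e.1 e.2},
      (if e.1.2 = x then (Ω * (1 - Λ).adjugate) y e.1.1 else 0) * K e.1.1 e.1.2 =
      (Ω * (1 - Λ).adjugate * K) y x := by
    intro x y
    have h1 : ∑ e : {e : V × V // G.D e.1 e.2},
        (if e.1.2 = x then (Ω * (1 - Λ).adjugate) y e.1.1 else 0) * K e.1.1 e.1.2 =
        ∑ e : V × V, (if e.2 = x then (Ω * (1 - Λ).adjugate) y e.1 else 0) * K e.1 e.2 :=
      Fintype.sum_of_injective Subtype.val Subtype.val_injective _ _ (fun e he => by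
        rw [hK e.1 e.2 fun h => he ⟨⟨e, h⟩, rfl⟩, mul_zero]) fun _ => rfl
    rw [h1, Fintype.sum_prod_type, Matrix.mul_apply]
    refine Finset.sum_congr rfl fun u _ => ?_
    simp
  rw [← key v w, ← key w v, ← Finset.sum_add_distrib]
  refine Finset.sum_congr rfl fun e _ => ?_
  simp only [tangentMatrix, Matrix.of_apply, hvw, hB, ne_eq, not_false_eq_true, and_self, if_true,
    add_mul]

end Projection

/-! ### Integral curves inside fibers. -/

section InfiniteFibers

variable {V : Type*} [Fintype V] [DecidableEq V] {G : MixedGraph V}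

/-- The fiber through a point is infinite if a polynomial tangent direction along which the
covariance matrix is constant does not vanish there. -/
theorem infinite_fiber {K : Matrix V V (MvPolynomial ((V × V) ⊕ (V × V)) ℝ)}
    (hKD : ∀ u v, ¬ G.D u v → K u v = 0)
    (hK : ∀ θ ∈ G.support, ∀ v w, v ≠ w → ¬ G.B v w →
      (θ.2 * (1 - θ.1).adjugate * K.map (MvPolynomial.eval (pairEntries θ))) w v +
      (θ.2 * (1 - θ.1).adjugate * K.map (MvPolynomial.eval (pairEntries θ))) v w = 0)
    {θ₀ : Matrix V V ℝ × Matrix V V ℝ} (hθ₀ : θ₀ ∈ G.Theta) {u v : V}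
    (hne : MvPolynomial.eval (pairEntries θ₀) (K u v) ≠ 0) : (G.fiber θ₀).Infinite := by
  classical
  let Λp : Matrix V V (MvPolynomial ((V × V) ⊕ (V × V)) ℝ) :=
    Matrix.of fun v w => MvPolynomial.X (Sum.inl (v, w))
  let Ωp : Matrix V V (MvPolynomial ((V × V) ⊕ (V × V)) ℝ) :=
    Matrix.of fun v w => MvPolynomial.X (Sum.inr (v, w))
  let W := Ωp * (1 - Λp).adjugate * K
  -- The factor det(I - Λ) turns (I - Λ)⁻¹ into the adjugate, so the field is polynomial. Composing
  -- with the projection makes `hK` applicable along the curve before the curve is known to stay in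
  -- the support space.
  let F : (V × V) ⊕ (V × V) → MvPolynomial ((V × V) ⊕ (V × V)) ℝ :=
    Sum.elim (fun e => G.projectHom ((1 - Λp).det * K e.1 e.2))
      (fun e => G.projectHom (-(W e.1 e.2 + W e.2 e.1)))
  obtain ⟨α, hα0, ε, hε, hα⟩ := MvPolynomial.exists_integralCurve F (pairEntries θ₀)
  let θ : ℝ → Matrix V V ℝ × Matrix V V ℝ := fun t =>
    (Matrix.of fun v w => α t (Sum.inl (v, w)), Matrix.of fun v w => α t (Sum.inr (v, w)))
  have hpe : ∀ t, pairEntries (θ t) = α t := by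
    intro t
    funext i
    rcases i with ⟨v, w⟩ | ⟨v, w⟩ <;> rfl
  have hθ0 : θ 0 = θ₀ := by
    refine Prod.ext ?_ ?_
    · ext v w
      simp [θ, hα0, pairEntries, entries]
    · ext v w
      simp [θ, hα0, pairEntries, entries]
  have hΛev : ∀ η : Matrix V V ℝ × Matrix V V ℝ,
      Λp.map (MvPolynomial.eval (pairEntries η)) = η.1 := by
    intro η
    ext v w
    simp [Λp, pairEntries, entries]
  have hΩev : ∀ η : Matrix V V ℝ × Matrix V V ℝ,
      Ωp.map (MvPolynomial.eval (pairEntries η)) = η.2 := by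
    intro η
    ext v w
    simp [Ωp, pairEntries, entries]
  have h1ev : ∀ η : Matrix V V ℝ × Matrix V V ℝ,
      (1 - Λp).map (MvPolynomial.eval (pairEntries η)) = 1 - η.1 := by
    intro η
    rw [Matrix.map_sub _ (map_sub _), Matrix.map_one _ (map_zero _) (map_one _), hΛev]
  let Wev : Matrix V V ℝ × Matrix V V ℝ → Matrix V V ℝ := fun η =>
    η.2 * (1 - η.1).adjugate * K.map (MvPolynomial.eval (pairEntries η))
  have hWev : ∀ (η : Matrix V V ℝ × Matrix V V ℝ) a b,
      MvPolynomial.eval (pairEntries η) (W a b) = Wev η a b := by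
    intro η a b
    change (W.map (MvPolynomial.eval (pairEntries η))) a b = _
    simp only [W, Wev]
    rw [Matrix.map_mul, Matrix.map_mul, hΩev, ← RingHom.mapMatrix_apply _ (1 - Λp).adjugate,
      RingHom.map_adjugate, RingHom.mapMatrix_apply, h1ev]
  have hdetev : ∀ η : Matrix V V ℝ × Matrix V V ℝ,
      MvPolynomial.eval (pairEntries η) (1 - Λp).det = (1 - η.1).det := by
    intro η
    rw [eval_det, h1ev]
  have hl : ∀ t ∈ Set.Ioo (-ε) ε, ∀ a b, HasDerivAt (fun s => (θ s).1 a b)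
      ((1 - (G.project (α t)).1).det *
        MvPolynomial.eval (pairEntries (G.project (α t))) (K a b)) t := by
    intro t ht a b
    have := hα t ht (Sum.inl (a, b))
    simp only [F, Sum.elim_inl] at this
    rwa [eval_projectHom, map_mul, hdetev] at this
  have hr : ∀ t ∈ Set.Ioo (-ε) ε, ∀ a b, HasDerivAt (fun s => (θ s).2 a b)
      (-(Wev (G.project (α t)) a b + Wev (G.project (α t)) b a)) t := by
    intro t ht a b
    have := hα t ht (Sum.inr (a, b))
    simp only [F, Sum.elim_inr] at this
    rwa [eval_projectHom, map_neg, map_add, hWev, hWev] at this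
  have hθ₀s := Theta_subset_support hθ₀
  -- Each linear equation of the support space has derivative zero along the curve and holds at time
  -- 0.
  have hsupp : ∀ t ∈ Set.Ioo (-ε) ε, θ t ∈ G.support := by
    intro t ht
    refine ⟨fun a b hab => ?_, ?_, fun a b hab hB => ?_⟩
    · have h1 := eq_of_forall_hasDerivAt_zero hε (f := fun s => (θ s).1 a b) (fun s hs => by
        have := hl s hs a b
        rwa [hKD a b hab, map_zero, mul_zero] at this) ht
      change (θ t).1 a b = (θ 0).1 a b at h1
      rw [h1, hθ0, hθ₀s.1 a b hab]
    · ext a b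
      have h1 := eq_of_forall_hasDerivAt_zero hε (f := fun s => (θ s).2 b a - (θ s).2 a b)
        (fun s hs => by
          have := (hr s hs b a).fun_sub (hr s hs a b)
          rwa [add_comm (Wev _ b a), sub_self] at this) ht
      change (θ t).2 b a - (θ t).2 a b = (θ 0).2 b a - (θ 0).2 a b at h1
      rw [hθ0, hθ₀s.2.1.apply, sub_self, sub_eq_zero] at h1
      exact h1
    · have h1 := eq_of_forall_hasDerivAt_zero hε (f := fun s => (θ s).2 a b) (fun s hs => by
        have := hr s hs a b
        rwa [add_comm, hK _ (project_mem_support _) a b hab hB, neg_zero] at this) ht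
      change (θ t).2 a b = (θ 0).2 a b at h1
      rw [h1, hθ0, hθ₀s.2.2 a b hab hB]
  have hproj : ∀ t ∈ Set.Ioo (-ε) ε, G.project (α t) = θ t := fun t ht => by
    rw [← hpe, project_pairEntries (hsupp t ht)]
  have h0mem : (0 : ℝ) ∈ Set.Ioo (-ε) ε := ⟨by linarith, hε⟩
  have hdet0 : (1 - (θ 0).1).det ≠ 0 := by
    rw [hθ0]
    exact ((Matrix.isUnit_iff_isUnit_det _).mp hθ₀.1.2).ne_zero
  have hdetcont : ∀ t ∈ Set.Ioo (-ε) ε, ContinuousAt (fun s => (1 - (θ s).1).det) t :=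
    fun t ht => (Matrix.differentiableAt_det fun a b =>
      ((hl t ht a b).const_sub _).differentiableAt).continuousAt
  obtain ⟨δ, hδ, hδdet⟩ := Metric.eventually_nhds_iff.mp
    ((hdetcont 0 h0mem).eventually_ne hdet0)
  let ρ := min δ ε
  have hρ : 0 < ρ := lt_min hδ hε
  have hρε : ∀ t ∈ Set.Ioo (-ρ) ρ, t ∈ Set.Ioo (-ε) ε := fun t ht =>
    ⟨by linarith [ht.1, min_le_right δ ε], by linarith [ht.2, min_le_right δ ε]⟩
  have hdet : ∀ t ∈ Set.Ioo (-ρ) ρ, (1 - (θ t).1).det ≠ 0 := fun t ht => by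
    refine hδdet ?_
    rw [Real.dist_eq, sub_zero, abs_lt]
    exact ⟨by linarith [ht.1, min_le_left δ ε], by linarith [ht.2, min_le_left δ ε]⟩
  have hphi : ∀ t ∈ Set.Ioo (-ρ) ρ, phi (θ t) = phi θ₀ := by
    intro t ht
    ext i j
    rw [← hθ0]
    refine eq_of_forall_hasDerivAt_zero hρ (f := fun s => phi (θ s) i j) (fun s hs => ?_) ht
    have hs' := hρε s hs
    have hls := hl s hs'
    have hrs := hr s hs'
    rw [hproj s hs'] at hls hrs
    refine hasDerivAt_phi_apply
      (Λ' := (1 - (θ s).1).det • K.map (MvPolynomial.eval (pairEntries (θ s))))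
      (Ω' := -(Wev (θ s) + (Wev (θ s))ᵀ)) (fun a b => hls a b) (fun a b => hrs a b) ?_ ?_ i j
    · filter_upwards [isOpen_Ioo.mem_nhds hs] with x hx using hdet x hx
    · have hadj : (1 - (θ s).1)⁻¹ *
          ((1 - (θ s).1).det • K.map (MvPolynomial.eval (pairEntries (θ s)))) =
          (1 - (θ s).1).adjugate * K.map (MvPolynomial.eval (pairEntries (θ s))) := by
        rw [Matrix.mul_smul, ← Matrix.smul_mul, Matrix.inv_def, smul_smul,
          Ring.mul_inverse_cancel _ (isUnit_iff_ne_zero.mpr (hdet s hs)), one_smul]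
      have hW : (θ s).2 * ((1 - (θ s).1).adjugate *
          K.map (MvPolynomial.eval (pairEntries (θ s)))) = Wev (θ s) := by
        rw [← mul_assoc]
      have hWT : ((1 - (θ s).1).adjugate *
          K.map (MvPolynomial.eval (pairEntries (θ s))))ᵀ * (θ s).2 = (Wev (θ s))ᵀ := by
        rw [← hW, Matrix.transpose_mul _ ((1 - (θ s).1).adjugate * _), (hsupp s hs').2.1.eq]
      rw [hadj, hW, hWT]
      abel
  -- Since Σ is constant on the curve, Ω = (I - Λ)ᵀΣ(I - Λ) remains positive definite wherever I - Λ
  -- is invertible.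
  have hpos : (phi θ₀).PosDef := by
    have := hθ₀.2.1.conjTranspose_mul_mul_same (B := (1 - θ₀.1)⁻¹)
      (Matrix.mulVec_injective_iff_isUnit.mpr
        (Matrix.isUnit_nonsing_inv_iff.mpr hθ₀.1.2))
    rwa [Matrix.conjTranspose_eq_transpose_of_trivial] at this
  have hfiber : ∀ t ∈ Set.Ioo (-ρ) ρ, θ t ∈ G.fiber θ₀ := by
    intro t ht
    have hu : IsUnit (1 - (θ t).1) :=
      (Matrix.isUnit_iff_isUnit_det _).mpr (isUnit_iff_ne_zero.mpr (hdet t ht))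
    have hs := hsupp t (hρε t ht)
    refine ⟨⟨⟨hs.1, hu⟩, ?_, hs.2.2⟩, hphi t ht⟩
    rw [← one_sub_transpose_mul_phi_mul hu, hphi t ht]
    have := hpos.conjTranspose_mul_mul_same (B := 1 - (θ t).1)
      (Matrix.mulVec_injective_iff_isUnit.mpr hu)
    simpa [Matrix.conjTranspose_eq_transpose_of_trivial] using this
  -- This coordinate has nonzero derivative at 0, so its image is a connected set of reals with at
  -- least two points.
  have hcoord : ((fun t => (θ t).1 u v) '' Set.Ioo (-ρ) ρ).Infinite := by
    refine (isPreconnected_Ioo.image _ fun t ht =>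
      ((hl t (hρε t ht) u v).continuousAt).continuousWithinAt).infinite_of_nontrivial ?_
    have hd := hl 0 h0mem u v
    have hd0 : (1 - (G.project (α 0)).1).det *
        MvPolynomial.eval (pairEntries (G.project (α 0))) (K u v) ≠ 0 := by
      rw [hproj 0 h0mem]
      refine mul_ne_zero hdet0 ?_
      rwa [hθ0]
    have hIoo : ∀ᶠ t in 𝓝[≠] (0 : ℝ), t ∈ Set.Ioo (-ρ) ρ :=
      nhdsWithin_le_nhds (Ioo_mem_nhds (by linarith) hρ)
    obtain ⟨t, ht, ht'⟩ := ((hd.eventually_ne hd0 (c := (θ 0).1 u v)).and hIoo).exists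
    exact ⟨_, ⟨t, ht', rfl⟩, _, ⟨0, ⟨by linarith, hρ⟩, rfl⟩, ht⟩
  refine Set.Infinite.of_image (fun η : Matrix V V ℝ × Matrix V V ℝ => η.1 u v)
    (hcoord.mono ?_)
  rintro _ ⟨t, ht, rfl⟩
  exact ⟨θ t, hfiber t ht, rfl⟩

theorem HTCInfiniteToOne.genericallyInfiniteToOne (h : G.HTCInfiniteToOne) :
    G.GenericallyInfiniteToOne := by
  classical
  obtain ⟨κ, hκ, e, η, hη, hne⟩ := h.exists_kernel
  let K : Matrix V V (MvPolynomial ((V × V) ⊕ (V × V)) ℝ) :=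
    Matrix.of fun u v => if h : G.D u v then κ ⟨(u, v), h⟩ else 0
  have hKD : ∀ u v, ¬ G.D u v → K u v = 0 := fun u v h => dif_neg h
  have hKe : ∀ e : {e : V × V // G.D e.1 e.2}, K e.1.1 e.1.2 = κ e := fun e => dif_pos e.2
  refine exists_isProperAlgebraicSubset (eventually_generic_of_eval hη hne fun θ hθ hθne =>
    infinite_fiber hKD (fun θ hθ v w hvw hB => ?_) hθ (by rwa [hKe]))
  rw [← tangentMatrix_mulVec θ.1 θ.2 _ (fun a b hab => by simp [hKD a b hab]) hvw hB]
  simp only [Matrix.map_apply, hKe]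
  exact congrFun (hκ θ hθ) (v, w)

end InfiniteFibers

end MixedGraph

theorem theorem3 {V : Type*} [Fintype V] [DecidableEq V] (G : MixedGraph V) :
    (G.WeakHTCIdentifiable → G.RationallyIdentifiable) ∧
    (G.WeakHTCInfiniteToOne → G.GenericallyInfiniteToOne) ∧
    (G.WeakHTCIdentifiable ↔ G.HTCIdentifiable) ∧
    (G.WeakHTCInfiniteToOne ↔ G.HTCInfiniteToOne) :=
  ⟨fun h => (MixedGraph.weakHTCIdentifiable_iff.mp h).rationallyIdentifiable,
    fun h => (MixedGraph.weakHTCInfiniteToOne_iff.mp h).genericallyInfiniteToOne,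
    MixedGraph.weakHTCIdentifiable_iff, MixedGraph.weakHTCInfiniteToOne_iff⟩
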